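/- Labels are $\pm1$ and $\mathrm{sign}(0)=+1$. For a class $\mathcal C$ of functions $X\to\{\pm1\}$ let $\mathrm{Maj}_k(\mathcal C)$ be the class of all functions $x\mapsto\mathrm{sign}(c_1(x)+\cdots+c_k(x))$ with $c_1,\dots,c_k\in\mathcal C$. The error of a randomized hypothesis $h$ (a probability distribution over functions $X\to\{\pm1\}$) with respect to a target $c^\star$ over a distribution $\mathcal D$ on $X$ is $\mathrm{error}_{\mathcal D}(h,c^\star)=\Pr_{x\sim\mathcal D,\,g\sim h}[g(x)\ne c^\star(x)]$. A dataset $S$ of size $n$ is generated from $c^\star$ over $\mathcal D$ with $\eta$-nasty noise as follows. A clean sample $S^\circ=((x_1,c^\star(x_1)),\dots,(x_n,c^\star(x_n)))$ with $x_1,\dots,x_n$ i.i.d. from $\mathcal D$ is drawn. After seeing it, an adversary chooses a (random) set $J\subseteq[n]$ of indices such that the marginal law of $|J|$ is $\mathrm{Bin}(n,\eta)$, and then changes the entries of $S^\circ$ with index in $J$ arbitrarily; $S$ is the result. A learner is a (not necessarily efficient) map $A$ from datasets of size $n$ to randomized hypotheses. It $(e,\delta)$-learns $\mathcal C$ with $\eta$-nasty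 noise over $\mathcal D$ if for every $c^\star\in\mathcal C$ and every adversary, with probability at least $1-\delta$, $\mathrm{error}_{\mathcal D}(A(S),c^\star)\le e$. Theorem. There is an absolute constant $K>0$ such that the following holds. Let $\mathcal D$ be a probability distribution on $X$, let $\mathcal C$ be a nonempty class of measurable functions $X\to\{\pm1\}$ of finite VC dimension $d$, let $\varepsilon>0$ and $\delta\in(0,1)$, and let $n$, $k$ be integers with $$n\ \ge\ K\,\frac{d+\log(1/\delta)}{\varepsilon^2}\qquad\text{and}\qquad k\ \ge\ \frac{K}{\varepsilon^2}.$$ Then there is a learner $A$ (depending on $\mathcal C$, $\mathcal D$, $\varepsilon$, $\delta$, $n$, $k$, but not on $\eta$) using $n$ samples such that for every dataset $S$ the hypothesis $A(S)$ is a mixture of functions in $\mathrm{Maj}_k(\mathcal C)$, and such that for every $\eta\in[0,1]$ the learner $A$ $(\eta+\varepsilon,\delta)$-learns $\mathcal C$ with $\eta$-nasty noise over $\mathcal D$. In particular $O((d+\log(1/\delta))/\varepsilon^2)$ samples and majorities of $k=O(1/\varepsilon^2)$ concepts suffice. -/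

import Mathlib

open MeasureTheory ProbabilityTheory
open scoped ENNReal

universe u v

namespace NastyLearning

/-- The sign `±1` coded by a Boolean label: `true` is `+1` and `false` is `-1`. -/
def sgn (b : Bool) : ℤ := if b then 1 else -1

/-- A class `C` of functions `X → {±1}` shatters the finite set `T` if every labeling of `T`
is realized by a member of `C`. -/
def Shatters {X : Type u} (C : Set (X → Bool)) (T : Finset X) : Prop :=
  ∀ y : X → Bool, ∃ c ∈ C, ∀ x ∈ T, c x = y x

/-- The VC dimension of `C`: the supremum of the cardinalities of the finite sets that `C`
shatters. -/
noncomputable def vcDim {X : Type u} (C : Set (X → Bool)) : ℕ∞ :=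
  ⨆ (T : Finset X) (_ : Shatters C T), (T.card : ℕ∞)

/-- The majority `x ↦ sign (c₁(x) + ⋯ + c_k(x))`, where `sign 0 = +1`. -/
def majority {X : Type u} {k : ℕ} (c : Fin k → X → Bool) : X → Bool :=
  fun x => decide (0 ≤ ∑ i, sgn (c i x))

/-- The class of all majorities of `k` members of `C` (repetitions are allowed). -/
def Maj {X : Type u} (k : ℕ) (C : Set (X → Bool)) : Set (X → Bool) :=
  {h | ∃ c : Fin k → X → Bool, (∀ i, c i ∈ C) ∧ h = majority c}

/-- The error `Pr_{x ∼ D, g ∼ h}[g(x) ≠ c(x)]` of the randomized hypothesis `h`, a discrete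
mixture of functions `X → {±1}`, with respect to the target `c`. -/
noncomputable def error {X : Type u} [MeasurableSpace X] (D : Measure X)
    (h : PMF (X → Bool)) (c : X → Bool) : ℝ≥0∞ :=
  ∑' g : X → Bool, h g * D {x | g x ≠ c x}

/-- The dataset `S` of size `n` is generated from the target `c` over the distribution `D` with
`η`-nasty noise: `x` is the clean i.i.d. sample, `J` is the set of corrupted indices, chosen by the
adversary in any dependence on the clean sample provided that its size has the binomial law
`Bin(n, η)`, and `S` agrees with the clean labeled sample outside `J`. The adversary may be
randomized; nothing else is required of `J` and `S`, not even measurability. -/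
structure IsNastySample {X : Type u} [MeasurableSpace X] (D : Measure X) (c : X → Bool)
    (η : unitInterval) {n : ℕ} {Ω : Type v} [MeasurableSpace Ω] (P : Measure Ω)
    (x : Ω → Fin n → X) (J : Ω → Finset (Fin n)) (S : Ω → Fin n → X × Bool) : Prop where
  clean : HasLaw x (Measure.pi fun _ => D) P
  card_corrupted : HasLaw (fun ω => (J ω).card) (binomial n η) P
  agree : ∀ ω, ∀ i, i ∉ J ω → S ω i = (x ω i, c (x ω i))

/-- The learner `A`, which maps a dataset of size `n` to a randomized hypothesis,
`(e, δ)`-learns `C` with `η`-nasty noise over the fixed distribution `D`: for every target in `C`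
and every adversary, the probability that the hypothesis has error greater than `e` is at most
`δ`. (For an event that is not measurable, `P` is the outer measure, so that the requirement is
only stronger.) -/
def LearnsWithNastyNoise {X : Type u} [MeasurableSpace X] (C : Set (X → Bool)) (D : Measure X)
    (η : unitInterval) (e δ : ℝ) {n : ℕ} (A : (Fin n → X × Bool) → PMF (X → Bool)) : Prop :=
  ∀ c ∈ C, ∀ (Ω : Type v) [MeasurableSpace Ω] (P : Measure Ω) [IsProbabilityMeasure P]
    (x : Ω → Fin n → X) (J : Ω → Finset (Fin n)) (S : Ω → Fin n → X × Bool),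
    IsNastySample D c η P x J S →
      P {ω | ENNReal.ofReal e < error D (A (S ω)) c} ≤ ENNReal.ofReal δ

end NastyLearning

namespace NastyLearning

/-! The learner solves a finite game. Replace `C` by a finite `γ`-net. A `k`-tuple `t` of net
elements gives a vote `q = avgSgn t` in `[-1, 1]`, and `voteWeight b q = 1 / (1 + max (b q) 0)`
weighs a point with label `b`. The `refutation` of a concept `c` by `t` is the expected weight under
`c` minus the average over the dataset of the weights of the points consistent with `c`. Let `R c`
be its supremum over `t`.

The target has small `R`. On the clean sample the two terms agree up to `τ`, uniformly in `t`, and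
one corrupted entry lowers the second by at most `1 / n`, because weights lie in `[0, 1]`. So `R c ≤
|J| / n + τ` (`refutation_le`), which gives `η` with factor one.

For every dataset some mixture of majorities has error at most `R c + 1 / √k` for all `c` in the net
simultaneously (`exists_mixture_of_majorities`). By minimax it suffices to beat one prior `μ` on the
net with one tuple. Draw `t` from `μ` independently; then `q` is within `1 / √k` of the `μ`-mean
vote `p`, on average. Suppose `q = p`. The concepts giving a point label `b` have mass `(1 + b p) /
2`, and this mass times the weight is at most `1 / 2`, with equality when `b` is the majority label.
Hence the dataset term has `μ`-mean at most `1 / 2`. Where the majority errs the weight is `1` and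
cancels the error, so error minus expected weight has mean `-1 / 2`. The halves cancel; the
deviation of `q` from `p` is the only loss.

Uniform convergence must not depend on `k`. Symmetrization leads to a Rademacher process; the weight
is `1`-Lipschitz in the vote, so contraction removes it, and a vote is an average of concepts, so
its supremum is at most that over the class. Chaining with Dudley's packing bound controls the
latter without a logarithm (`sum_exp_iSup_le_of_vc`). Exponential moments are used throughout, so
that Markov's inequality yields the tail directly. -/

/-- The sign `±1` coded by a Boolean label, as a real number. -/
def rsgn (b : Bool) : ℝ := if b then 1 else -1

lemma sgn_cast (b : Bool) : ((sgn b : ℤ) : ℝ) = rsgn b := by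
  cases b <;> simp [sgn, rsgn]

@[simp] lemma rsgn_true : rsgn true = 1 := by simp [rsgn]

@[simp] lemma rsgn_false : rsgn false = -1 := by simp [rsgn]

@[simp] lemma rsgn_not (b : Bool) : rsgn (!b) = -rsgn b := by cases b <;> simp

lemma abs_rsgn (b : Bool) : |rsgn b| = 1 := by cases b <;> simp

lemma rsgn_sq (b : Bool) : rsgn b ^ 2 = 1 := by cases b <;> simp

/-! ### Exponential moments of Rademacher sums. -/

section Rademacher

variable {ι A : Type*} [Fintype ι]

/-- The signed sum `∑ i, ± v i`. -/
def signedSum (σ : ι → Bool) (v : ι → ℝ) : ℝ := ∑ i, rsgn (σ i) * v i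

lemma signedSum_add (σ : ι → Bool) (v w : ι → ℝ) :
    signedSum σ (v + w) = signedSum σ v + signedSum σ w := by
  simp [signedSum, mul_add, Finset.sum_add_distrib]

/-- The sum over signs factors into coordinates, and `cosh v ≤ exp (v ^ 2 / 2)` in each. -/
lemma sum_exp_signedSum_le [DecidableEq ι] (v : ι → ℝ) :
    ∑ σ : ι → Bool, Real.exp (signedSum σ v) ≤
      2 ^ Fintype.card ι * Real.exp ((∑ i, v i ^ 2) / 2) := by
  have h1 : ∑ σ : ι → Bool, Real.exp (signedSum σ v) =
      ∏ i, ∑ b : Bool, Real.exp (rsgn b * v i) := by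
    rw [Finset.prod_univ_sum, Fintype.piFinset_univ]
    exact Finset.sum_congr rfl fun σ _ => Real.exp_sum _ _
  have h2 : ∀ i, ∑ b : Bool, Real.exp (rsgn b * v i) ≤ 2 * Real.exp (v i ^ 2 / 2) := by
    intro i
    have := Real.cosh_le_exp_half_sq (v i)
    rw [Real.cosh_eq] at this
    simp only [Fintype.sum_bool, rsgn_true, rsgn_false, one_mul, neg_one_mul]
    linarith
  rw [h1]
  refine (Finset.prod_le_prod (fun i _ => by positivity) fun i _ => h2 i).trans (le_of_eq ?_)
  rw [Finset.prod_mul_distrib, Finset.prod_const, ← Real.exp_sum, Finset.sum_div]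
  simp

lemma exp_ciSup_eq [Finite A] [Nonempty A] (f : A → ℝ) :
    ∃ a, Real.exp (⨆ a, f a) = Real.exp (f a) := by
  obtain ⟨a, ha⟩ := exists_eq_ciSup_of_finite (f := f)
  exact ⟨a, by rw [ha]⟩

lemma le_ciSup_finite [Finite A] (f : A → ℝ) (a : A) : f a ≤ ⨆ a, f a :=
  le_ciSup (Set.finite_range f).bddAbove a

/-- Massart's finite class lemma, for exponential moments. -/
lemma sum_exp_iSup_signedSum_le [DecidableEq ι] [Finite A] [Nonempty A] (F : A → ι → ℝ) (N B : ℝ)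
    (s : Finset (ι → ℝ)) (hs : (s.card : ℝ) ≤ N) (hF : ∀ a, F a ∈ s)
    (hB : ∀ a, ∑ i, F a i ^ 2 ≤ B) :
    ∑ σ : ι → Bool, Real.exp (⨆ a, signedSum σ (F a)) ≤
      2 ^ Fintype.card ι * (N * Real.exp (B / 2)) := by
  classical
  -- The set `s` may contain vectors that are not values of `F` and violate the norm bound.
  set s' := s.filter fun w => ∑ i, w i ^ 2 ≤ B
  have h1 : ∀ σ : ι → Bool, Real.exp (⨆ a, signedSum σ (F a)) ≤
      ∑ w ∈ s', Real.exp (signedSum σ w) := by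
    intro σ
    obtain ⟨a, ha⟩ := exp_ciSup_eq fun a => signedSum σ (F a)
    rw [ha]
    exact Finset.single_le_sum (f := fun w => Real.exp (signedSum σ w))
      (fun w _ => (Real.exp_pos _).le) (Finset.mem_filter.2 ⟨hF a, hB a⟩)
  refine (Finset.sum_le_sum fun σ _ => h1 σ).trans ?_
  rw [Finset.sum_comm]
  have h2 : ∀ w ∈ s', ∑ σ : ι → Bool, Real.exp (signedSum σ w) ≤
      2 ^ Fintype.card ι * Real.exp (B / 2) := by
    intro w hw
    refine (sum_exp_signedSum_le w).trans ?_
    have := (Finset.mem_filter.1 hw).2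
    gcongr
  refine (Finset.sum_le_sum h2).trans ?_
  rw [Finset.sum_const, nsmul_eq_mul]
  have h3 : (s'.card : ℝ) ≤ N := le_trans (by exact_mod_cast Finset.card_filter_le _ _) hs
  calc (s'.card : ℝ) * (2 ^ Fintype.card ι * Real.exp (B / 2))
      ≤ N * (2 ^ Fintype.card ι * Real.exp (B / 2)) := by gcongr
    _ = _ := by ring

/-- The Cauchy–Schwarz inequality for exponential moments, in logarithmic form. -/
lemma sum_exp_add_le {S : Type*} [Fintype S] (f g : S → ℝ) (W s t : ℝ)
    (hf : ∑ σ, Real.exp (2 * f σ) ≤ W * Real.exp s)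
    (hg : ∑ σ, Real.exp (2 * g σ) ≤ W * Real.exp t) :
    ∑ σ, Real.exp (f σ + g σ) ≤ W * Real.exp ((s + t) / 2) := by
  have h : ∀ σ, Real.exp (f σ + g σ) ≤ Real.exp ((s + t) / 2) / 2 *
      (Real.exp (2 * f σ) * Real.exp (-s) + Real.exp (2 * g σ) * Real.exp (-t)) := by
    intro σ
    have e1 : Real.exp (f σ + g σ) = Real.exp ((s + t) / 2) *
        (Real.exp (f σ - s / 2) * Real.exp (g σ - t / 2)) := by
      rw [← Real.exp_add, ← Real.exp_add]; ring_nf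
    have e2 : Real.exp (2 * f σ) * Real.exp (-s) = Real.exp (f σ - s / 2) ^ 2 := by
      rw [← Real.exp_add, ← Real.exp_nat_mul]; push_cast; ring_nf
    have e3 : Real.exp (2 * g σ) * Real.exp (-t) = Real.exp (g σ - t / 2) ^ 2 := by
      rw [← Real.exp_add, ← Real.exp_nat_mul]; push_cast; ring_nf
    rw [e1, e2, e3, div_mul_eq_mul_div, mul_div_assoc]
    gcongr
    nlinarith [sq_nonneg (Real.exp (f σ - s / 2) - Real.exp (g σ - t / 2))]
  refine (Finset.sum_le_sum fun σ _ => h σ).trans ?_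
  rw [← Finset.mul_sum, Finset.sum_add_distrib, ← Finset.sum_mul, ← Finset.sum_mul]
  have h1 : (∑ σ, Real.exp (2 * f σ)) * Real.exp (-s) ≤ W := by
    rw [Real.exp_neg, ← div_eq_mul_inv, div_le_iff₀ (Real.exp_pos _)]; exact hf
  have h2 : (∑ σ, Real.exp (2 * g σ)) * Real.exp (-t) ≤ W := by
    rw [Real.exp_neg, ← div_eq_mul_inv, div_le_iff₀ (Real.exp_pos _)]; exact hg
  nlinarith [Real.exp_pos ((s + t) / 2)]

/-- Weak majorization for `exp`: with capitals for exponentials, `(X - P) (X - Q) ≥ 0` and `P Q ≤ X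
Y` give `P + Q ≤ X + Y`. -/
lemma exp_add_exp_le_of_le {p q x y : ℝ} (hq : q ≤ x) (h : p + q ≤ x + y) (hp : p ≤ x) :
    Real.exp p + Real.exp q ≤ Real.exp x + Real.exp y := by
  have h1 : Real.exp p ≤ Real.exp x := Real.exp_le_exp.2 hp
  have h2 : Real.exp q ≤ Real.exp x := Real.exp_le_exp.2 hq
  have h3 : Real.exp p * Real.exp q ≤ Real.exp x * Real.exp y := by
    rw [← Real.exp_add, ← Real.exp_add]; exact Real.exp_le_exp.2 h
  by_contra! hc
  have := Real.exp_pos x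
  nlinarith [mul_nonneg (sub_nonneg.2 h1) (sub_nonneg.2 h2)]

/-- The one-coordinate case of the contraction principle for exponential moments. -/
lemma exp_iSup_add_exp_iSup_le [Finite A] [Nonempty A] (a u v : A → ℝ)
    (h0 : ∀ s, |u s| ≤ |v s|) (h : ∀ s t, |u s - u t| ≤ |v s - v t|) :
    Real.exp (⨆ s, (a s + u s)) + Real.exp (⨆ s, (a s - u s)) ≤
      Real.exp (⨆ s, (a s + v s)) + Real.exp (⨆ s, (a s - v s)) := by
  obtain ⟨s, hs⟩ := exists_eq_ciSup_of_finite (f := fun s => a s + u s)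
  obtain ⟨t, ht⟩ := exists_eq_ciSup_of_finite (f := fun s => a s - u s)
  have hs' : a t + u t ≤ a s + u s := hs ▸ le_ciSup_finite (fun s => a s + u s) t
  have ht' : a s - u s ≤ a t - u t := ht ▸ le_ciSup_finite (fun s => a s - u s) s
  rw [← hs, ← ht]
  have hp : ∀ r, Real.exp (a r + v r) ≤ Real.exp (⨆ s, (a s + v s)) := fun r =>
    Real.exp_le_exp.2 (le_ciSup_finite (fun s => a s + v s) r)
  have hm : ∀ r, Real.exp (a r - v r) ≤ Real.exp (⨆ s, (a s - v s)) := fun r =>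
    Real.exp_le_exp.2 (le_ciSup_finite (fun s => a s - v s) r)
  have key : ∀ w : A → ℝ, (∀ s, |u s| ≤ |w s|) → (∀ s t, |u s - u t| ≤ |w s - w t|) →
      w t ≤ w s →
      Real.exp (a s + u s) + Real.exp (a t - u t) ≤
        Real.exp (a s + w s) + Real.exp (a t - w t) := by
    intro w hw0 hw hts
    have b1 := hw0 s
    have b2 := hw0 t
    have b3 := hw s t
    rw [abs_of_nonneg (sub_nonneg.2 hts)] at b3
    have b3' := (abs_le.1 b3)
    have b1' := abs_le.1 b1
    have b2' := abs_le.1 b2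
    rcases le_total 0 (w t) with h1 | h1
    · have h2 : 0 ≤ w s := h1.trans hts
      rw [abs_of_nonneg h1] at b2'
      rw [abs_of_nonneg h2] at b1'
      exact exp_add_exp_le_of_le (by linarith) (by linarith) (by linarith)
    · rw [abs_of_nonpos h1] at b2'
      rcases le_total 0 (w s) with h2 | h2
      · rw [abs_of_nonneg h2] at b1'
        exact add_le_add (Real.exp_le_exp.2 (by linarith)) (Real.exp_le_exp.2 (by linarith))
      · rw [abs_of_nonpos h2] at b1'
        rw [add_comm, add_comm (Real.exp (a s + w s))]
        exact exp_add_exp_le_of_le (by linarith) (by linarith) (by linarith)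
  -- The right side is symmetric under `v ↦ -v`, so the order of `v s` and `v t` may be prescribed.
  rcases le_total (v t) (v s) with h1 | h1
  · exact (key v h0 h h1).trans (add_le_add (hp s) (hm t))
  · refine (key (fun s => -v s) (by simpa using h0) (fun s t => ?_) (by simpa using h1)).trans ?_
    · rw [neg_sub_neg, abs_sub_comm (v t)]; exact h s t
    · have := hm s
      have := hp t
      simp only [← sub_eq_add_neg, sub_neg_eq_add]
      linarith

end Rademacher

/-! ### The contraction principle. -/

section Contraction

variable {ι A : Type*} [Fintype ι] [DecidableEq ι]

/-- Negation of one coordinate of a sign vector. -/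
def flip (j : ι) (σ : ι → Bool) : ι → Bool := Function.update σ j (!σ j)

omit [Fintype ι] in
lemma flip_flip (j : ι) (σ : ι → Bool) : flip j (flip j σ) = σ := by
  simp [flip]

lemma sum_flip (j : ι) (f : (ι → Bool) → ℝ) : ∑ σ, f (flip j σ) = ∑ σ, f σ :=
  Equiv.sum_comp (Function.Involutive.toPerm (flip j) (flip_flip j)) f

lemma signedSum_eq_add (j : ι) (σ : ι → Bool) (v : ι → ℝ) :
    signedSum σ v = ∑ i ∈ Finset.univ.erase j, rsgn (σ i) * v i + rsgn (σ j) * v j := by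
  rw [signedSum, add_comm, Finset.add_sum_erase _ (fun i => rsgn (σ i) * v i) (Finset.mem_univ j)]

lemma signedSum_flip (j : ι) (σ : ι → Bool) (v : ι → ℝ) :
    signedSum (flip j σ) v =
      ∑ i ∈ Finset.univ.erase j, rsgn (σ i) * v i - rsgn (σ j) * v j := by
  rw [signedSum_eq_add j, sub_eq_add_neg]
  congr 1
  · refine Finset.sum_congr rfl fun i hi => ?_
    rw [flip, Function.update_of_ne (Finset.ne_of_mem_erase hi)]
  · simp [flip]

/-- The contraction principle of Ledoux and Talagrand for exponential moments. -/
lemma sum_exp_iSup_contraction [Finite A] [Nonempty A] (U V : A → ι → ℝ)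
    (h0 : ∀ s i, |U s i| ≤ |V s i|) (h : ∀ s t i, |U s i - U t i| ≤ |V s i - V t i|) :
    ∑ σ : ι → Bool, Real.exp (⨆ s, signedSum σ (U s)) ≤
      ∑ σ : ι → Bool, Real.exp (⨆ s, signedSum σ (V s)) := by
  -- Coordinates are exchanged one at a time; pairing `σ` with `flip j σ` reduces each exchange to
  -- the one-coordinate inequality.
  suffices H : ∀ J : Finset ι, ∑ σ : ι → Bool, Real.exp (⨆ s, signedSum σ (U s)) ≤
      ∑ σ : ι → Bool, Real.exp (⨆ s, signedSum σ fun i => if i ∈ J then V s i else U s i) by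
    simpa using H Finset.univ
  intro J
  induction J using Finset.induction_on with
  | empty => simp
  | insert j J hj ih =>
    refine ih.trans ?_
    set P : A → ι → ℝ := fun s i => if i ∈ J then V s i else U s i
    set Q : A → ι → ℝ := fun s i => if i ∈ insert j J then V s i else U s i
    change ∑ σ : ι → Bool, Real.exp (⨆ s, signedSum σ (P s)) ≤
      ∑ σ : ι → Bool, Real.exp (⨆ s, signedSum σ (Q s))
    have hPQ : ∀ s, ∀ i ∈ Finset.univ.erase j, P s i = Q s i := by
      intro s i hi
      simp [P, Q, Finset.ne_of_mem_erase hi]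
    have hPj : ∀ s, P s j = U s j := fun s => by simp [P, hj]
    have hQj : ∀ s, Q s j = V s j := fun s => by simp [Q]
    have two : ∀ f : (ι → Bool) → ℝ, 2 * ∑ σ, f σ = ∑ σ, (f σ + f (flip j σ)) := fun f => by
      rw [Finset.sum_add_distrib, sum_flip]; ring
    refine le_of_mul_le_mul_left ?_ (zero_lt_two (α := ℝ))
    rw [two, two]
    refine Finset.sum_le_sum fun σ _ => ?_
    have key := exp_iSup_add_exp_iSup_le
      (fun s => ∑ i ∈ Finset.univ.erase j, rsgn (σ i) * Q s i)
      (fun s => rsgn (σ j) * U s j) (fun s => rsgn (σ j) * V s j)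
      (fun s => by simpa [abs_mul, abs_rsgn] using h0 s j)
      (fun s t => by
        rw [← mul_sub, ← mul_sub, abs_mul, abs_mul, abs_rsgn, one_mul, one_mul]
        exact h s t j)
    have e1 : ∀ s, ∑ i ∈ Finset.univ.erase j, rsgn (σ i) * P s i =
        ∑ i ∈ Finset.univ.erase j, rsgn (σ i) * Q s i := fun s =>
      Finset.sum_congr rfl fun i hi => by rw [hPQ s i hi]
    simp only [signedSum_flip j, signedSum_eq_add j σ, e1, hPj, hQj]
    exact key

end Contraction

/-! ### Chaining for exponential moments. -/

section Chaining

variable {ι A : Type*} [Fintype ι]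

lemma ciSup_add_le [Finite A] [Nonempty A] (f g : A → ℝ) :
    ⨆ a, (f a + g a) ≤ (⨆ a, f a) + ⨆ a, g a :=
  ciSup_le fun a => add_le_add (le_ciSup_finite f a) (le_ciSup_finite g a)

lemma mul_ciSup_signedSum {c : ℝ} (hc : 0 ≤ c) (σ : ι → Bool)
    (F : A → ι → ℝ) : c * ⨆ a, signedSum σ (F a) = ⨆ a, signedSum σ (c • F a) := by
  rw [Real.mul_iSup_of_nonneg hc]
  congr 1
  ext a
  simp only [signedSum, Pi.smul_apply, smul_eq_mul, Finset.mul_sum]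
  exact Finset.sum_congr rfl fun i _ => by ring

variable [DecidableEq ι]

/-- Increments of one link of a chain of approximations. -/
lemma sum_exp_link_le [Finite A] [Nonempty A] (G H : A → ι → ℝ) (s t : Finset (ι → ℝ))
    (hG : ∀ a, G a ∈ s) (hH : ∀ a, H a ∈ t) {L M B : ℝ} (hs : (s.card : ℝ) ≤ Real.exp L)
    (ht : (t.card : ℝ) ≤ Real.exp M) (hB : ∀ a, ∑ i, (G a i - H a i) ^ 2 ≤ B) (lam : ℝ)
    (hlam : 0 ≤ lam) :
    ∑ σ : ι → Bool, Real.exp (lam * ⨆ a, signedSum σ (G a - H a)) ≤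
      2 ^ Fintype.card ι * Real.exp (L + M + lam ^ 2 * B / 2) := by
  classical
  simp only [mul_ciSup_signedSum hlam]
  refine (sum_exp_iSup_signedSum_le (fun a => lam • (G a - H a)) (Real.exp (L + M))
    (lam ^ 2 * B) ((s ×ˢ t).image fun p => lam • (p.1 - p.2)) ?_ ?_ ?_).trans_eq ?_
  · rw [Real.exp_add]
    refine le_trans ?_ (mul_le_mul hs ht (by positivity) (by positivity))
    exact_mod_cast Finset.card_image_le.trans_eq (Finset.card_product s t)
  · intro a
    exact Finset.mem_image.2 ⟨(G a, H a), Finset.mk_mem_product (hG a) (hH a), rfl⟩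
  · intro a
    simp only [Pi.smul_apply, Pi.sub_apply, smul_eq_mul, mul_pow, ← Finset.mul_sum]
    exact mul_le_mul_of_nonneg_left (hB a) (by positivity)
  · rw [← Real.exp_add]

/-- Dudley's chaining bound, for exponential moments: the `j`-th approximation `G j` of `F` has
squared error at most `4 n / 4 ^ j` and takes at most `exp (d (5 + 3 j))` values. -/
lemma sum_exp_chaining_le [Finite A] [Nonempty A] (F : A → ι → ℝ) (G : ℕ → A → ι → ℝ)
    (s : ℕ → Finset (ι → ℝ)) (hG : ∀ j a, G j a ∈ s j) {d n : ℝ} (hd : 0 ≤ d) (hn : 0 ≤ n)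
    (hs : ∀ j : ℕ, ((s j).card : ℝ) ≤ Real.exp (d * (5 + 3 * j)))
    (hdist : ∀ j a, ∑ i, (F a i - G j a i) ^ 2 ≤ 4 * n / 4 ^ j)
    (J : ℕ) (hJ : ∀ a, G J a = F a) (lam : ℝ) (hlam : 0 ≤ lam) :
    ∑ σ : ι → Bool, Real.exp (lam * ⨆ a, signedSum σ (F a - G 0 a)) ≤
      2 ^ Fintype.card ι * Real.exp (19 * d + 20 * n * lam ^ 2) := by
  -- Backward induction from the finest level. Cauchy–Schwarz doubles `lam`, while the squared scale
  -- drops by `4`, so link and remainder both contribute `20 n lam ^ 2 / 4 ^ j`. The entropies `13 +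
  -- 6 j` and `25 + 6 j` average to `19 + 6 j`, which makes the bound self-reproducing.
  have main : ∀ m j : ℕ, j + m = J → ∀ lam : ℝ, 0 ≤ lam →
      ∑ σ : ι → Bool, Real.exp (lam * ⨆ a, signedSum σ (F a - G j a)) ≤
      2 ^ Fintype.card ι * Real.exp (d * (19 + 6 * j) + 20 * n / 4 ^ j * lam ^ 2) := by
    intro m
    induction m with
    | zero =>
      intro j hj lam hlam
      obtain rfl : j = J := by omega
      have h0 : ∀ σ : ι → Bool, Real.exp (lam * ⨆ a, signedSum σ (F a - G j a)) = 1 := by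
        intro σ
        simp [hJ, signedSum]
      simp only [h0, Finset.sum_const, Finset.card_univ, Fintype.card_fun, Fintype.card_bool,
        nsmul_eq_mul, mul_one, Nat.cast_pow, Nat.cast_ofNat]
      exact le_mul_of_one_le_right (by positivity) (Real.one_le_exp (by positivity))
    | succ m ih =>
      intro j hj lam hlam
      have h1 := ih (j + 1) (by omega) (2 * lam) (by linarith)
      have hB : ∀ a, ∑ i, (G (j + 1) a i - G j a i) ^ 2 ≤ 10 * n / 4 ^ j := by
        intro a
        have e1 := hdist j a
        have e2 := hdist (j + 1) a
        have e3 : ∑ i, (G (j + 1) a i - G j a i) ^ 2 ≤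
            2 * ∑ i, (F a i - G (j + 1) a i) ^ 2 + 2 * ∑ i, (F a i - G j a i) ^ 2 := by
          rw [Finset.mul_sum, Finset.mul_sum, ← Finset.sum_add_distrib]
          refine Finset.sum_le_sum fun i _ => ?_
          nlinarith [sq_nonneg ((F a i - G (j + 1) a i) + (F a i - G j a i))]
        have e4 : 2 * (4 * n / 4 ^ (j + 1)) + 2 * (4 * n / 4 ^ j) = 10 * n / 4 ^ j := by
          field_simp
          ring
        linarith
      have h2 := sum_exp_link_le (G (j + 1)) (G j) (s (j + 1)) (s j) (hG _) (hG _) (hs _) (hs _)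
        hB (2 * lam) (by linarith)
      have h3 := sum_exp_add_le (fun σ : ι → Bool => lam * ⨆ a, signedSum σ (G (j + 1) a - G j a))
        (fun σ => lam * ⨆ a, signedSum σ (F a - G (j + 1) a)) (2 ^ Fintype.card ι) _ _
        (by simpa only [mul_assoc] using h2) (by simpa only [mul_assoc] using h1)
      refine le_trans (Finset.sum_le_sum fun σ _ => Real.exp_le_exp.2 ?_)
        (h3.trans (mul_le_mul_of_nonneg_left (Real.exp_le_exp.2 ?_) (by positivity)))
      · rw [← mul_add]
        refine mul_le_mul_of_nonneg_left ?_ hlam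
        have e : ∀ a, signedSum σ (F a - G j a) =
            signedSum σ (G (j + 1) a - G j a) + signedSum σ (F a - G (j + 1) a) := by
          intro a
          rw [← signedSum_add]; congr 1; abel
        simp only [e]
        exact ciSup_add_le _ _
      · have e4 : 20 * n / 4 ^ (j + 1) = 5 * (n / 4 ^ j) := by
          field_simp; ring
        have e5 : 20 * n / 4 ^ j = 20 * (n / 4 ^ j) := by ring
        have e6 : 10 * n / 4 ^ j = 10 * (n / 4 ^ j) := by ring
        rw [e4, e5, e6]
        push_cast
        nlinarith
  simpa [mul_comm d] using main J 0 (by omega) lam hlam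

end Chaining

/-! ### Packing numbers of VC classes. -/

section Packing

/-- Sauer–Shelah for the traces on the points `y`, which determine the members of `S`. A shattered
set of indices has distinct points, so its image is a shattered set of the same size. -/
lemma card_le_sum_choose_of_shatters {Y : Type*} (S : Finset (Y → Bool)) (d m : ℕ)
    (hd : ∀ T : Finset Y, Shatters (S : Set (Y → Bool)) T → T.card ≤ d) (y : Fin m → Y)
    (hy : ∀ f ∈ S, ∀ g ∈ S, f ≠ g → ∃ i, f (y i) ≠ g (y i)) :
    S.card ≤ ∑ k ∈ Finset.Iic d, m.choose k := by
  classical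
  set Φ : (Y → Bool) → Finset (Fin m) := fun f => Finset.univ.filter fun i => f (y i) = true
  have hmem : ∀ f i, i ∈ Φ f ↔ f (y i) = true := fun f i => by simp [Φ]
  have hinj : Set.InjOn Φ S := by
    intro f hf g hg hfg
    by_contra hne
    obtain ⟨i, hi⟩ := hy f hf g hg hne
    apply hi
    have := (hmem f i).symm.trans ((by rw [hfg] : i ∈ Φ f ↔ i ∈ Φ g).trans (hmem g i))
    exact Bool.eq_iff_iff.2 this
  have hvc : (S.image Φ).vcDim ≤ d := by
    refine Finset.sup_le fun s hs => ?_
    rw [Finset.mem_shatterer] at hs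
    have hsur : ∀ l : Fin m → Bool, ∃ f ∈ S, ∀ i ∈ s, f (y i) = l i := by
      intro l
      obtain ⟨u, hu, hsu⟩ := hs (Finset.filter_subset (fun i => l i = true) s)
      obtain ⟨f, hf, rfl⟩ := Finset.mem_image.1 hu
      refine ⟨f, hf, fun i hi => ?_⟩
      have h1 : i ∈ s ∩ Φ f ↔ i ∈ s.filter fun i => l i = true := by rw [hsu]
      simp only [Finset.mem_inter, hmem, Finset.mem_filter, hi, true_and] at h1
      exact Bool.eq_iff_iff.2 h1
    have hyinj : Set.InjOn y s := by
      intro i hi j hj hij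
      by_contra hne
      obtain ⟨f, -, hf⟩ := hsur fun k => decide (k = i)
      have h1 := hf i hi
      have h2 := hf j hj
      rw [← hij, h1] at h2
      simp [Ne.symm hne] at h2
    rw [← Finset.card_image_of_injOn hyinj]
    refine hd _ fun l => ?_
    obtain ⟨f, hf, hfl⟩ := hsur fun i => l (y i)
    refine ⟨f, hf, fun x hx => ?_⟩
    obtain ⟨i, hi, rfl⟩ := Finset.mem_image.1 hx
    exact hfl i hi
  calc S.card = (S.image Φ).card := (Finset.card_image_of_injOn hinj).symm
    _ ≤ (S.image Φ).shatterer.card := Finset.card_le_card_shatterer _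
    _ ≤ ∑ k ∈ Finset.Iic (S.image Φ).vcDim, (Fintype.card (Fin m)).choose k :=
        Finset.card_shatterer_le_sum_vcDim
    _ ≤ ∑ k ∈ Finset.Iic d, m.choose k := by
        rw [Fintype.card_fin]
        exact Finset.sum_le_sum_of_subset (Finset.Iic_subset_Iic.2 hvc)

/-- Bound `x ^ d` by `x ^ k`, then sum by the binomial theorem. Leaving `x` free avoids any
comparison of `m` with `d`. -/
lemma sum_choose_mul_pow_le (d m : ℕ) {x : ℝ} (hx : 0 < x) (hx1 : x ≤ 1) :
    (∑ k ∈ Finset.Iic d, (m.choose k : ℝ)) * x ^ d ≤ Real.exp (x * m) := by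
  have h1 : (∑ k ∈ Finset.Iic d, (m.choose k : ℝ)) * x ^ d ≤
      ∑ k ∈ Finset.range (d + m + 1), x ^ k * (m.choose k : ℝ) := by
    rw [Finset.sum_mul]
    refine (Finset.sum_le_sum (g := fun k => x ^ k * (m.choose k : ℝ)) fun k hk => ?_).trans ?_
    · rw [mul_comm]
      exact mul_le_mul_of_nonneg_right
        (pow_le_pow_of_le_one hx.le hx1 (Finset.mem_Iic.1 hk)) (by positivity)
    · refine Finset.sum_le_sum_of_subset_of_nonneg (fun k hk => ?_) fun _ _ _ => by positivity
      rw [Finset.mem_Iic] at hk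
      rw [Finset.mem_range]; omega
  have h2 : ∑ k ∈ Finset.range (m + 1), x ^ k * (m.choose k : ℝ) =
      ∑ k ∈ Finset.range (d + m + 1), x ^ k * (m.choose k : ℝ) := by
    refine Finset.sum_subset (Finset.range_subset_range.2 (by omega)) fun k _ hk => ?_
    rw [Nat.choose_eq_zero_of_lt (by simpa using hk)]
    simp
  have h3 : (x + 1) ^ m = ∑ k ∈ Finset.range (m + 1), x ^ k * (m.choose k : ℝ) := by
    rw [add_pow]; simp
  rw [← h2, ← h3] at h1
  refine h1.trans ?_
  rw [mul_comm, Real.exp_nat_mul]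
  exact pow_le_pow_left₀ (by positivity) (Real.add_one_le_exp x) m

/-- Random points work: a pair agrees on all `m` of them with probability at most `exp (-γ m) ≤ |S|
^ (-2)`, and there are fewer than `|S| ^ 2` ordered pairs of distinct members. -/
lemma exists_separating_points {Y : Type*} [MeasurableSpace Y] (μ : Measure Y)
    [IsProbabilityMeasure μ] (S : Finset (Y → Bool)) (hS : ∀ f ∈ S, Measurable f)
    {γ : ℝ} (hγ : 0 < γ)
    (hsep : ∀ f ∈ S, ∀ g ∈ S, f ≠ g → γ ≤ μ.real {y | f y ≠ g y}) (hne : S.Nonempty) (m : ℕ)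
    (hm : 2 * Real.log S.card / γ ≤ m) :
    ∃ y : Fin m → Y, ∀ f ∈ S, ∀ g ∈ S, f ≠ g → ∃ i, f (y i) ≠ g (y i) := by
  classical
  by_contra! hcon
  have hM : (0 : ℝ) < S.card := by exact_mod_cast hne.card_pos
  set B : (Y → Bool) × (Y → Bool) → Set (Fin m → Y) := fun p =>
    Set.univ.pi fun _ => {y | p.1 y = p.2 y}
  have hB : ∀ p ∈ S.offDiag, (Measure.pi fun _ : Fin m => μ).real (B p) ≤
      ((S.card : ℝ) ^ 2)⁻¹ := by
    intro p hp
    rw [Finset.mem_offDiag] at hp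
    obtain ⟨h1, h2, h3⟩ := hp
    have e1 : μ.real {y | p.1 y = p.2 y} ≤ Real.exp (-γ) := by
      have hms : MeasurableSet {y | p.1 y = p.2 y} :=
        measurableSet_eq_fun (hS _ h1) (hS _ h2)
      have := probReal_compl_eq_one_sub (μ := μ) hms
      have h4 := hsep _ h1 _ h2 h3
      have h5 : {y | p.1 y ≠ p.2 y} = {y | p.1 y = p.2 y}ᶜ := rfl
      rw [h5, this] at h4
      linarith [Real.add_one_le_exp (-γ)]
    have e2 : (Measure.pi fun _ : Fin m => μ).real (B p) = μ.real {y | p.1 y = p.2 y} ^ m := by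
      simp [B, Measure.real, Measure.pi_pi]
    rw [e2]
    refine (pow_le_pow_left₀ measureReal_nonneg e1 m).trans ?_
    rw [← Real.exp_nat_mul, ← Real.exp_log (pow_pos hM 2), ← Real.exp_neg, Real.exp_le_exp,
      Real.log_pow]
    rw [div_le_iff₀ hγ] at hm
    push_cast
    linarith
  have hcover : (Set.univ : Set (Fin m → Y)) ⊆ ⋃ p ∈ S.offDiag, B p := by
    intro y _
    obtain ⟨f, hf, g, hg, hfg, h⟩ := hcon y
    simp only [Set.mem_iUnion]
    exact ⟨(f, g), Finset.mem_offDiag.2 ⟨hf, hg, hfg⟩, fun i _ => h i⟩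
  have h1 : (1 : ℝ) ≤ ∑ p ∈ S.offDiag, (Measure.pi fun _ : Fin m => μ).real (B p) := by
    calc (1 : ℝ) = (Measure.pi fun _ : Fin m => μ).real Set.univ := by simp
      _ ≤ (Measure.pi fun _ : Fin m => μ).real (⋃ p ∈ S.offDiag, B p) :=
          measureReal_mono hcover (measure_ne_top _ _)
      _ ≤ _ := measureReal_biUnion_finset_le _ _
  have h2 := h1.trans (Finset.sum_le_sum hB)
  rw [Finset.sum_const, nsmul_eq_mul, Finset.offDiag_card, ← div_eq_mul_inv,
    le_div_iff₀ (by positivity), one_mul, Nat.cast_sub (Nat.le_mul_self _)] at h2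
  push_cast at h2
  nlinarith

/-- Dudley's packing bound: a `γ`-separated set of a class of VC dimension `d` has at most
`(8 / γ) ^ (2 d)` elements. -/
lemma card_le_of_separated {Y : Type*} [MeasurableSpace Y] (μ : Measure Y)
    [IsProbabilityMeasure μ] (S : Finset (Y → Bool)) (hS : ∀ f ∈ S, Measurable f)
    {γ : ℝ} (hγ : 0 < γ) (hγ1 : γ ≤ 1)
    (hsep : ∀ f ∈ S, ∀ g ∈ S, f ≠ g → γ ≤ μ.real {y | f y ≠ g y}) (d : ℕ) (hd0 : 1 ≤ d)
    (hd : ∀ T : Finset Y, Shatters (S : Set (Y → Bool)) T → T.card ≤ d) :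
    (S.card : ℝ) ≤ Real.exp (2 * d * Real.log (8 / γ)) := by
  rcases S.eq_empty_or_nonempty with rfl | hne
  · simp [Real.exp_nonneg]
  have hM : (1 : ℝ) ≤ S.card := by exact_mod_cast hne.card_pos
  have hlog : 0 ≤ Real.log S.card := Real.log_nonneg hM
  set m := ⌈2 * Real.log S.card / γ⌉₊
  have hm1 : 2 * Real.log S.card / γ ≤ m := Nat.le_ceil _
  have hm2 : (m : ℝ) ≤ 2 * Real.log S.card / γ + 1 := (Nat.ceil_lt_add_one (by positivity)).le
  obtain ⟨y, hy⟩ := exists_separating_points μ S hS hγ hsep hne m hm1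
  have h1 : (S.card : ℝ) ≤ ∑ k ∈ Finset.Iic d, (m.choose k : ℝ) := by
    exact_mod_cast card_le_sum_choose_of_shatters S d m hd y hy
  -- With this `x` the exponent `x m` is at most `log |S| / 4 + 1 / 8`, which is absorbed on the
  -- left.
  have hx : 0 < γ / 8 := by positivity
  have h2 := sum_choose_mul_pow_le d m hx (by linarith)
  have h3 : (S.card : ℝ) * (γ / 8) ^ d ≤ Real.exp (γ / 8 * m) :=
    (mul_le_mul_of_nonneg_right h1 (by positivity)).trans h2
  have h4 := Real.log_le_log (by positivity) h3
  rw [Real.log_exp, Real.log_mul (by positivity) (by positivity), Real.log_pow] at h4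
  have h5 : Real.log (γ / 8) = -Real.log (8 / γ) := by
    rw [← Real.log_inv, inv_div]
  have h6 : γ / 8 * m ≤ Real.log S.card / 4 + 1 / 8 := by
    calc γ / 8 * m ≤ γ / 8 * (2 * Real.log S.card / γ + 1) := by gcongr
      _ = Real.log S.card / 4 + γ / 8 := by field_simp; ring
      _ ≤ _ := by linarith
  have h7 : 1 ≤ Real.log (8 / γ) := by
    rw [Real.le_log_iff_exp_le (by positivity)]
    have : (8 : ℝ) ≤ 8 / γ := by rw [le_div_iff₀ hγ]; linarith
    linarith [Real.exp_one_lt_three]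
  have hd1 : (1 : ℝ) ≤ d := by exact_mod_cast hd0
  rw [← Real.log_le_iff_le_exp (by positivity)]
  rw [h5] at h4
  have h8 : 1 ≤ d * Real.log (8 / γ) := by nlinarith
  nlinarith

lemma Shatters.mono {Y : Type*} {C C' : Set (Y → Bool)} (h : C ⊆ C') {T : Finset Y}
    (hT : Shatters C T) : Shatters C' T := fun y =>
  let ⟨c, hc, hy⟩ := hT y
  ⟨c, h hc, hy⟩

/-- A class of finite VC dimension has a finite `γ`-net of at most `(8 / γ) ^ (2 d)` elements. -/
lemma exists_net {Y : Type*} [MeasurableSpace Y] (μ : Measure Y)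
    [IsProbabilityMeasure μ] (C : Set (Y → Bool)) (hC : ∀ f ∈ C, Measurable f)
    {γ : ℝ} (hγ : 0 < γ) (hγ1 : γ ≤ 1) (d : ℕ) (hd0 : 1 ≤ d)
    (hd : ∀ T : Finset Y, Shatters C T → T.card ≤ d) :
    ∃ S : Finset (Y → Bool), ↑S ⊆ C ∧ (S.card : ℝ) ≤ Real.exp (2 * d * Real.log (8 / γ)) ∧
      ∀ c ∈ C, ∃ s ∈ S, μ.real {y | c y ≠ s y} < γ := by
  classical
  set sep : Finset (Y → Bool) → Prop := fun S => ↑S ⊆ C ∧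
    ∀ f ∈ S, ∀ g ∈ S, f ≠ g → γ ≤ μ.real {y | f y ≠ g y}
  have hcard : ∀ S, sep S → (S.card : ℝ) ≤ Real.exp (2 * d * Real.log (8 / γ)) := fun S hS =>
    card_le_of_separated μ S (fun f hf => hC f (hS.1 hf)) hγ hγ1 hS.2 d hd0
      fun T hT => hd T (hT.mono hS.1)
  -- The packing bound makes a separated set of maximal size available; by maximality it is a net.
  have hmem : sSup {m | ∃ S, sep S ∧ S.card = m} ∈ {m | ∃ S, sep S ∧ S.card = m} := by
    refine Nat.sSup_mem ⟨0, ∅, ⟨by simp, by simp⟩, rfl⟩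
      ⟨⌊Real.exp (2 * d * Real.log (8 / γ))⌋₊, ?_⟩
    rintro m ⟨S, hS, rfl⟩
    exact Nat.le_floor (hcard S hS)
  have hbdd : BddAbove {m | ∃ S, sep S ∧ S.card = m} :=
    ⟨⌊Real.exp (2 * d * Real.log (8 / γ))⌋₊, by
      rintro m ⟨S, hS, rfl⟩
      exact Nat.le_floor (hcard S hS)⟩
  obtain ⟨S, hS, hmax⟩ := hmem
  refine ⟨S, hS.1, hcard S hS, fun c hc => ?_⟩
  by_contra! hfar
  have hcS : c ∉ S := fun h => by
    have := hfar c h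
    simp at this
    linarith
  have hins : sep (insert c S) := by
    refine ⟨by simpa [Set.insert_subset_iff] using ⟨hc, hS.1⟩, fun f hf g hg hfg => ?_⟩
    rcases Finset.mem_insert.1 hf with rfl | hf' <;> rcases Finset.mem_insert.1 hg with rfl | hg'
    · exact absurd rfl hfg
    · exact hfar g hg'
    · simpa only [ne_comm] using hfar f hf'
    · exact hS.2 f hf' g hg' hfg
  have := le_csSup hbdd ⟨insert c S, hins, rfl⟩
  rw [← hmax, Finset.card_insert_of_notMem hcS] at this
  omega

end Packing

/-! ### The Rademacher process of a VC class. -/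

section VC

/-- The Rademacher process of a class of VC dimension `d` on `n` points has exponential moments
of order `exp (O (d + n lam ^ 2))`. -/
lemma sum_exp_iSup_le_of_vc {X : Type*} [MeasurableSpace X] {n : ℕ} (hn : 0 < n)
    (C : Finset (X → Bool)) [Nonempty C] (hC : ∀ c ∈ C, Measurable c) (d : ℕ) (hd0 : 1 ≤ d)
    (hd : ∀ T : Finset X, Shatters (C : Set (X → Bool)) T → T.card ≤ d) (x : Fin n → X)
    (lam : ℝ) (hlam : 0 ≤ lam) :
    ∑ σ : Fin n → Bool,
        Real.exp (lam * ⨆ c : C, signedSum σ fun i => rsgn ((c : X → Bool) (x i))) ≤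
      2 ^ n * Real.exp (12 * d + 41 * n * lam ^ 2) := by
  classical
  have : NeZero n := ⟨hn.ne'⟩
  have hn' : (0 : ℝ) < n := by exact_mod_cast hn
  have hx : Measurable x := measurable_of_finite x
  -- Under the empirical measure, squared Euclidean distance of sign vectors is `4 n` times the
  -- disagreement, so nets at scale `4 ^ (-j)` serve as the chain.
  set μ : Measure X := (uniformOn (Set.univ : Set (Fin n))).map x
  have hprob : IsProbabilityMeasure (uniformOn (Set.univ : Set (Fin n))) :=
    isProbabilityMeasure_uniformOn Set.finite_univ Set.univ_nonempty
  have hμ : IsProbabilityMeasure μ := Measure.isProbabilityMeasure_map hx.aemeasurable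
  have hdist : ∀ f ∈ C, ∀ g ∈ C, ∑ i, (rsgn (f (x i)) - rsgn (g (x i))) ^ 2 =
      4 * n * μ.real {y | f y ≠ g y} := by
    intro f hf g hg
    have hms : MeasurableSet {y | f y ≠ g y} :=
      (measurableSet_eq_fun (hC f hf) (hC g hg)).compl
    have e1 : μ.real {y | f y ≠ g y} =
        ((Finset.univ.filter fun i => f (x i) ≠ g (x i)).card : ℝ) / n := by
      rw [measureReal_def, Measure.map_apply hx hms, uniformOn_univ]
      have : x ⁻¹' {y | f y ≠ g y} =
          ((Finset.univ.filter fun i => f (x i) ≠ g (x i) : Finset (Fin n)) : Set (Fin n)) := by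
        ext; simp
      rw [this, Measure.count_apply_finset]
      simp
    have e2 : ∀ i, (rsgn (f (x i)) - rsgn (g (x i))) ^ 2 =
        4 * if f (x i) ≠ g (x i) then 1 else 0 := by
      intro i
      cases f (x i) <;> cases g (x i) <;> norm_num
    rw [e1, Finset.sum_congr rfl fun i _ => e2 i, ← Finset.mul_sum, Finset.sum_boole]
    field_simp
  have hnet := fun j : ℕ => exists_net μ (C : Set (X → Bool)) hC (γ := 1 / 4 ^ j) (by positivity)
    (by rw [div_le_one (by positivity)]; exact one_le_pow₀ (by norm_num)) d hd0 hd
  choose S hSC hScard hSnet using hnet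
  choose π hπ hπdist using fun (j : ℕ) (c : C) => hSnet j c c.2
  set F : C → Fin n → ℝ := fun c i => rsgn ((c : X → Bool) (x i))
  set G : ℕ → C → Fin n → ℝ := fun j c i => rsgn (π j c (x i))
  set s : ℕ → Finset (Fin n → ℝ) := fun j => (S j).image fun c i => rsgn (c (x i))
  have hG : ∀ j a, G j a ∈ s j := fun j a => Finset.mem_image.2 ⟨π j a, hπ j a, rfl⟩
  have hd1 : (0 : ℝ) ≤ d := by positivity
  have hlog2 : Real.log 2 ≤ 0.7 := by linarith [Real.log_two_lt_d9]
  have hlog0 : 0 < Real.log 2 := Real.log_pos (by norm_num)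
  have hs : ∀ j : ℕ, ((s j).card : ℝ) ≤ Real.exp (d * (5 + 3 * j)) := by
    intro j
    refine le_trans (by exact_mod_cast Finset.card_image_le) ((hScard j).trans ?_)
    rw [Real.exp_le_exp]
    have : Real.log (8 / (1 / 4 ^ j)) = (3 + 2 * j) * Real.log 2 := by
      have : (8 : ℝ) / (1 / 4 ^ j) = 2 ^ (3 + 2 * j) := by
        rw [pow_add, pow_mul]; norm_num
      rw [this, Real.log_pow]; push_cast; ring
    rw [this]
    have hj : (0 : ℝ) ≤ j := by positivity
    have : 2 * ((3 + 2 * j) * Real.log 2) ≤ 5 + 3 * (j : ℝ) := by nlinarith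
    calc 2 * (d : ℝ) * ((3 + 2 * j) * Real.log 2) = d * (2 * ((3 + 2 * j) * Real.log 2)) := by ring
      _ ≤ _ := by gcongr
  have hFG : ∀ j a, ∑ i, (F a i - G j a i) ^ 2 = 4 * n * μ.real {y | (a : X → Bool) y ≠ π j a y} :=
    fun j a => hdist a a.2 _ (hSC j (hπ j a))
  have hFG' : ∀ j a, ∑ i, (F a i - G j a i) ^ 2 ≤ 4 * n / 4 ^ j := by
    intro j a
    rw [hFG, div_eq_mul_one_div]
    exact mul_le_mul_of_nonneg_left (hπdist j a).le (by positivity)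
  -- Beyond this level the squared distance is below `4`, the cost of a single disagreement, so the
  -- approximation is exact.
  obtain ⟨J, hJ⟩ : ∃ J : ℕ, (n : ℝ) < 4 ^ J := pow_unbounded_of_one_lt _ (by norm_num)
  have hJF : ∀ a, G J a = F a := by
    intro a
    by_contra hne
    obtain ⟨i, hi⟩ := Function.ne_iff.1 hne
    have h1 : (4 : ℝ) ≤ (F a i - G J a i) ^ 2 := by
      simp only [F, G] at hi ⊢
      revert hi
      cases (a : X → Bool) (x i) <;> cases π J a (x i) <;> norm_num
    have h2 := (Finset.single_le_sum (f := fun i => (F a i - G J a i) ^ 2)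
      (fun i _ => sq_nonneg _) (Finset.mem_univ i)).trans (hFG' J a)
    have h3 : 4 * (n : ℝ) / 4 ^ J < 4 := by
      rw [div_lt_iff₀ (by positivity)]; linarith
    linarith
  have h1 := sum_exp_chaining_le F G s hG hd1 hn'.le hs hFG' J hJF (2 * lam) (by linarith)
  have h2 : ∑ σ : Fin n → Bool, Real.exp (2 * lam * ⨆ a, signedSum σ (G 0 a)) ≤
      2 ^ n * Real.exp (5 * d + 2 * n * lam ^ 2) := by
    have := sum_exp_link_le (G 0) (fun _ => 0) (s 0) {0} (hG 0) (by simp) (hs 0)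
      (M := 0) (by simp) (B := n) (fun a => by
        simp [G, rsgn_sq]) (2 * lam) (by linarith)
    simp only [sub_zero, Fintype.card_fin] at this
    refine this.trans_eq ?_
    congr 2
    push_cast
    ring
  -- Averaging the exponents `19 d + 80 n lam ^ 2` of the chain and `5 d + 2 n lam ^ 2` of its root
  -- gives `12 d + 41 n lam ^ 2`.
  have h3 := sum_exp_add_le (fun σ : Fin n → Bool => lam * ⨆ a, signedSum σ (F a - G 0 a))
    (fun σ => lam * ⨆ a, signedSum σ (G 0 a)) (2 ^ n) _ _
    (by simpa only [mul_assoc, Fintype.card_fin] using h1) (by simpa only [mul_assoc] using h2)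
  refine le_trans (Finset.sum_le_sum fun σ _ => Real.exp_le_exp.2 ?_)
    (h3.trans (mul_le_mul_of_nonneg_left (Real.exp_le_exp.2 ?_) (by positivity)))
  · rw [← mul_add]
    refine mul_le_mul_of_nonneg_left ?_ hlam
    have e : ∀ a, signedSum σ (F a) = signedSum σ (F a - G 0 a) + signedSum σ (G 0 a) := by
      intro a
      rw [← signedSum_add]; congr 1; abel
    change ⨆ a, signedSum σ (F a) ≤ _
    simp only [e]
    exact ciSup_add_le _ _
  · nlinarith

end VC

/-! ### Symmetrization and uniform deviations. -/

section Symmetrization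

variable {X A : Type*} [MeasurableSpace X] [Finite A] [Nonempty A] {n : ℕ}

omit [Finite A] [Nonempty A] in
lemma sum_exp_neg_signedSum (F : A → Fin n → ℝ) (lam : ℝ) :
    ∑ σ : Fin n → Bool, Real.exp (lam * ⨆ a, signedSum σ (-F a)) =
      ∑ σ : Fin n → Bool, Real.exp (lam * ⨆ a, signedSum σ (F a)) := by
  have hinv : Function.Involutive fun (σ : Fin n → Bool) i => !σ i := fun σ => by ext; simp
  rw [← Equiv.sum_comp (Function.Involutive.toPerm _ hinv)
    fun σ => Real.exp (lam * ⨆ a, signedSum σ (-F a))]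
  refine Finset.sum_congr rfl fun σ _ => ?_
  have : ∀ a, signedSum (Function.Involutive.toPerm _ hinv σ) (-F a) = signedSum σ (F a) := by
    intro a
    simp [signedSum, Function.Involutive.toPerm]
  simp only [this]

omit [Nonempty A] in
lemma measurable_exp_iSup {Y : Type*} [MeasurableSpace Y] (lam : ℝ) (F : A → Y → ℝ)
    (hF : ∀ a, Measurable (F a)) : Measurable fun y => Real.exp (lam * ⨆ a, F a y) :=
  ((Measurable.iSup hF).const_mul lam).exp

omit [Finite A] in
lemma exp_iSup_le_exp {lam B : ℝ} (hlam : 0 ≤ lam) (F : A → ℝ) (hF : ∀ a, F a ≤ B) :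
    Real.exp (lam * ⨆ a, F a) ≤ Real.exp (lam * B) :=
  Real.exp_le_exp.2 (mul_le_mul_of_nonneg_left (ciSup_le hF) hlam)

lemma integrable_exp_iSup {Y : Type*} [MeasurableSpace Y] (μ : Measure Y) [IsFiniteMeasure μ]
    {lam B : ℝ} (hlam : 0 ≤ lam) (F : A → Y → ℝ) (hF : ∀ a, Measurable (F a))
    (hB : ∀ a y, F a y ≤ B) : Integrable (fun y => Real.exp (lam * ⨆ a, F a y)) μ := by
  refine Integrable.of_bound (measurable_exp_iSup lam F hF).aestronglyMeasurable
    (Real.exp (lam * B)) (Filter.Eventually.of_forall fun y => ?_)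
  rw [Real.norm_of_nonneg (Real.exp_pos _).le]
  exact exp_iSup_le_exp hlam _ fun a => hB a y

lemma exp_integral_le {Y : Type*} [MeasurableSpace Y] (μ : Measure Y) [IsProbabilityMeasure μ]
    {f : Y → ℝ} (hf : Integrable f μ) (hexp : Integrable (fun y => Real.exp (f y)) μ) :
    Real.exp (∫ y, f y ∂μ) ≤ ∫ y, Real.exp (f y) ∂μ :=
  convexOn_exp.map_integral_le Real.continuous_exp.continuousOn isClosed_univ
    (Filter.Eventually.of_forall fun _ => Set.mem_univ _) hf hexp

lemma integral_comp_measurePreserving {Y Z : Type*} [MeasurableSpace Y] [MeasurableSpace Z]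
    {μ : Measure Y} {ν : Measure Z} {g : Y → Z} (hg : MeasurePreserving g μ ν) {f : Z → ℝ}
    (hf : Integrable f ν) : ∫ y, f (g y) ∂μ = ∫ z, f z ∂ν := by
  rw [← hg.map_eq] at hf ⊢
  exact (integral_map hg.measurable.aemeasurable hf.aestronglyMeasurable).symm

/-- Symmetrization with a ghost sample, for exponential moments. -/
lemma integral_exp_iSup_le_ghost (D : Measure X) [IsProbabilityMeasure D] (ψ : A → X → ℝ)
    (hψ : ∀ a, Measurable (ψ a)) (hb : ∀ a x, |ψ a x| ≤ 1) {lam : ℝ} (hlam : 0 ≤ lam)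
    (x : Fin n → X) :
    Real.exp (lam * ⨆ a, ∑ i, (∫ y, ψ a y ∂D - ψ a (x i))) ≤
      ∫ x' : Fin n → X, Real.exp (lam * ⨆ a, ∑ i, (ψ a (x' i) - ψ a (x i)))
        ∂(Measure.pi fun _ => D) := by
  obtain ⟨a, ha⟩ := exists_eq_ciSup_of_finite (f := fun a => ∑ i, (∫ y, ψ a y ∂D - ψ a (x i)))
  rw [← ha]
  set P : Measure (Fin n → X) := Measure.pi fun _ => D
  have hint : ∀ i, Integrable (fun x' : Fin n → X => ψ a (x' i)) P := fun i =>
    Integrable.of_bound ((hψ a).comp (measurable_pi_apply i)).aestronglyMeasurable 1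
      (Filter.Eventually.of_forall fun x' => by simpa using hb a (x' i))
  have hev : ∀ i, ∫ x' : Fin n → X, ψ a (x' i) ∂P = ∫ y, ψ a y ∂D := fun i =>
    integral_comp_eval (μ := fun _ : Fin n => D) (hψ a).aestronglyMeasurable
  have h1 : lam * ∑ i, (∫ y, ψ a y ∂D - ψ a (x i)) =
      ∫ x' : Fin n → X, lam * ∑ i, (ψ a (x' i) - ψ a (x i)) ∂P := by
    rw [integral_const_mul, integral_finsetSum (f := fun i (x' : Fin n → X) => ψ a (x' i) - ψ a (x i)) _
      fun i _ => (hint i).sub (integrable_const _)]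
    congr 1
    refine Finset.sum_congr rfl fun i _ => ?_
    rw [integral_sub (hint i) (integrable_const _), hev]
    simp
  have hbd : ∀ b (x' : Fin n → X), ∑ i, (ψ b (x' i) - ψ b (x i)) ≤ n * 2 := by
    intro b x'
    refine (Finset.sum_le_sum (g := fun _ => (2 : ℝ)) fun i _ => ?_).trans (by simp)
    linarith [(abs_le.1 (hb b (x' i))).2, (abs_le.1 (hb b (x i))).1]
  have hmeas : ∀ b, Measurable fun x' : Fin n → X => ∑ i, (ψ b (x' i) - ψ b (x i)) := fun b =>
    Finset.measurable_sum _ fun i _ => ((hψ b).comp (measurable_pi_apply i)).sub_const _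
  have hint1 : Integrable (fun x' : Fin n → X => lam * ∑ i, (ψ a (x' i) - ψ a (x i))) P :=
    (integrable_finsetSum _ fun i _ => (hint i).sub (integrable_const _)).const_mul _
  have hint2 : Integrable (fun x' : Fin n → X =>
      Real.exp (lam * ∑ i, (ψ a (x' i) - ψ a (x i)))) P := by
    simpa using integrable_exp_iSup (A := Unit) P hlam (fun _ x' => ∑ i, (ψ a (x' i) - ψ a (x i)))
      (fun _ => hmeas a) (fun _ => hbd a)
  rw [h1]
  refine (exp_integral_le P hint1 hint2).trans ?_
  refine integral_mono hint2 (integrable_exp_iSup P hlam _ hmeas hbd) fun x' => ?_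
  exact Real.exp_le_exp.2 (mul_le_mul_of_nonneg_left (le_ciSup_finite
    (fun a => ∑ i, (ψ a (x' i) - ψ a (x i))) a) hlam)

/-- The exchange of the coordinates of the pairs `z i` with `σ i = false`. -/
def swapPairs (σ : Fin n → Bool) (z : Fin n → X × X) : Fin n → X × X :=
  fun i => if σ i then z i else (z i).swap

lemma measurePreserving_swapPairs (D : Measure X) [IsProbabilityMeasure D] (σ : Fin n → Bool) :
    MeasurePreserving (swapPairs σ) (Measure.pi fun _ => D.prod D)
      (Measure.pi fun _ => D.prod D) := by
  refine measurePreserving_pi (fun _ : Fin n => D.prod D) (fun _ => D.prod D)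
    (f := fun i p => if σ i then p else p.swap) fun i => ?_
  cases σ i
  · simpa using Measure.measurePreserving_swap (μ := D) (ν := D)
  · exact MeasurePreserving.id (D.prod D)

/-- Exchanging sample and ghost points preserves the law, so random signs may be inserted.
Cauchy–Schwarz then separates the two samples, hence the factor `2` in the hypothesis. -/
lemma integral_exp_iSup_le (D : Measure X) [IsProbabilityMeasure D] (ψ : A → X → ℝ)
    (hψ : ∀ a, Measurable (ψ a)) (hb : ∀ a x, |ψ a x| ≤ 1) {lam s : ℝ} (hlam : 0 ≤ lam)
    (hs : ∀ x : Fin n → X, ∑ σ : Fin n → Bool,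
      Real.exp (2 * lam * ⨆ a, signedSum σ fun i => ψ a (x i)) ≤ 2 ^ n * Real.exp s) :
    ∫ x : Fin n → X, Real.exp (lam * ⨆ a, ∑ i, (∫ y, ψ a y ∂D - ψ a (x i)))
      ∂(Measure.pi fun _ => D) ≤ Real.exp s := by
  set P : Measure (Fin n → X) := Measure.pi fun _ => D
  set Q : Measure (Fin n → X × X) := Measure.pi fun _ => D.prod D
  have hbd : ∀ a (u v : X), |ψ a u - ψ a v| ≤ 2 := fun a u v =>
    (abs_sub _ _).trans (by linarith [hb a u, hb a v])
  have hsum : ∀ a (σ : Fin n → Bool) (z : Fin n → X × X),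
      signedSum σ (fun i => ψ a (z i).2 - ψ a (z i).1) ≤ n * 2 := by
    intro a σ z
    refine (Finset.sum_le_sum (g := fun _ => (2 : ℝ)) fun i _ => ?_).trans (by simp)
    refine (le_abs_self _).trans ?_
    rw [abs_mul, abs_rsgn, one_mul]
    exact hbd a _ _
  have hm2 : ∀ a i, Measurable fun z : Fin n → X × X => ψ a (z i).2 - ψ a (z i).1 := fun a i =>
    ((hψ a).comp (measurable_snd.comp (measurable_pi_apply i))).sub
      ((hψ a).comp (measurable_fst.comp (measurable_pi_apply i)))
  have hmσ : ∀ (σ : Fin n → Bool) a, Measurable fun z : Fin n → X × X =>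
      signedSum σ (fun i => ψ a (z i).2 - ψ a (z i).1) := fun σ a =>
    Finset.measurable_sum _ fun i _ => (hm2 a i).const_mul _
  set H : (Fin n → Bool) → (Fin n → X × X) → ℝ := fun σ z =>
    Real.exp (lam * ⨆ a, signedSum σ (fun i => ψ a (z i).2 - ψ a (z i).1))
  have hHint : ∀ σ, Integrable (H σ) Q := fun σ =>
    integrable_exp_iSup Q hlam _ (hmσ σ) (fun a z => hsum a σ z)
  have hswap : ∀ σ, ∫ z, H σ z ∂Q = ∫ z, H (fun _ => true) z ∂Q := by
    intro σ
    rw [← integral_comp_measurePreserving (measurePreserving_swapPairs D σ) (hHint fun _ => true)]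
    refine integral_congr_ae (Filter.Eventually.of_forall fun z => ?_)
    have : ∀ a, signedSum σ (fun i => ψ a (z i).2 - ψ a (z i).1) =
        signedSum (fun _ => true)
          (fun i => ψ a (swapPairs σ z i).2 - ψ a (swapPairs σ z i).1) := by
      intro a
      refine Finset.sum_congr rfl fun i _ => ?_
      cases h : σ i <;> simp [swapPairs, h]
    simp only [H, this]
  have hpt : ∀ z, ∑ σ, H σ z ≤ 2 ^ n * Real.exp s := by
    intro z
    have h1 := hs fun i => (z i).2
    have h2 := hs fun i => (z i).1
    rw [← sum_exp_neg_signedSum] at h2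
    have h3 := sum_exp_add_le
      (fun σ : Fin n → Bool => lam * ⨆ a, signedSum σ fun i => ψ a (z i).2)
      (fun σ => lam * ⨆ a, signedSum σ (-fun i => ψ a (z i).1)) (2 ^ n) s s
      (by simpa only [mul_assoc] using h1) (by simpa only [mul_assoc] using h2)
    rw [add_self_div_two] at h3
    refine (Finset.sum_le_sum fun σ _ => Real.exp_le_exp.2 ?_).trans h3
    rw [← mul_add]
    refine mul_le_mul_of_nonneg_left ?_ hlam
    have e : ∀ a, signedSum σ (fun i => ψ a (z i).2 - ψ a (z i).1) =
        signedSum σ (fun i => ψ a (z i).2) + signedSum σ (-fun i => ψ a (z i).1) := by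
      intro a
      rw [← signedSum_add]; congr 1
    simp only [e]
    exact ciSup_add_le _ _
  have hQ : ∫ z, H (fun _ => true) z ∂Q ≤ Real.exp s := by
    have h1 : ∑ σ : Fin n → Bool, ∫ z, H σ z ∂Q ≤ 2 ^ n * Real.exp s := by
      rw [← integral_finsetSum _ fun σ _ => hHint σ]
      refine (integral_mono (integrable_finsetSum _ fun σ _ => hHint σ)
        (integrable_const (2 ^ n * Real.exp s)) hpt).trans_eq (by simp)
    simp only [hswap, Finset.sum_const, Finset.card_univ, Fintype.card_fun, Fintype.card_bool,
      Fintype.card_fin, nsmul_eq_mul, Nat.cast_pow, Nat.cast_ofNat] at h1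
    exact le_of_mul_le_mul_left h1 (by positivity)
  set K : (Fin n → X) × (Fin n → X) → ℝ := fun p =>
    Real.exp (lam * ⨆ a, ∑ i, (ψ a (p.2 i) - ψ a (p.1 i)))
  have hbdK : ∀ a (p : (Fin n → X) × (Fin n → X)), ∑ i, (ψ a (p.2 i) - ψ a (p.1 i)) ≤ n * 2 := by
    intro a p
    refine (Finset.sum_le_sum (g := fun _ => (2 : ℝ)) fun i _ => ?_).trans (by simp)
    exact (le_abs_self _).trans (hbd a _ _)
  have hmK : ∀ a, Measurable fun p : (Fin n → X) × (Fin n → X) =>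
      ∑ i, (ψ a (p.2 i) - ψ a (p.1 i)) := fun a =>
    Finset.measurable_sum _ fun i _ =>
      ((hψ a).comp ((measurable_pi_apply i).comp measurable_snd)).sub
        ((hψ a).comp ((measurable_pi_apply i).comp measurable_fst))
  have hKint : Integrable K (P.prod P) := integrable_exp_iSup _ hlam _ hmK hbdK
  have hKQ : ∫ p, K p ∂(P.prod P) = ∫ z, H (fun _ => true) z ∂Q := by
    rw [← integral_comp_measurePreserving
      (measurePreserving_arrowProdEquivProdArrow X X (Fin n) (fun _ => D) fun _ => D) hKint]
    refine integral_congr_ae (Filter.Eventually.of_forall fun z => ?_)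
    simp [K, H, signedSum, MeasurableEquiv.arrowProdEquivProdArrow,
      Equiv.arrowProdEquivProdArrow]
  calc _ ≤ ∫ x, ∫ x', K (x, x') ∂P ∂P := by
        refine integral_mono ?_ hKint.integral_prod_left fun x =>
          integral_exp_iSup_le_ghost D ψ hψ hb hlam x
        refine integrable_exp_iSup P hlam (B := n * 2) _ (fun a => ?_) fun a x => ?_
        · exact Finset.measurable_sum _ fun i _ =>
            ((hψ a).comp (measurable_pi_apply i)).const_sub _
        · refine (Finset.sum_le_sum (g := fun _ => (2 : ℝ)) fun i _ => ?_).trans (by simp)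
          have h1 : ‖∫ y, ψ a y ∂D‖ ≤ 1 * D.real Set.univ :=
            norm_integral_le_of_norm_le_const (Filter.Eventually.of_forall fun y => hb a y)
          rw [probReal_univ, mul_one, Real.norm_eq_abs] at h1
          linarith [(abs_le.1 h1).2, (abs_le.1 (hb a (x i))).1]
    _ = ∫ p, K p ∂(P.prod P) := (integral_prod _ hKint).symm
    _ ≤ _ := hKQ.trans_le hQ

/-- A uniform one-sided deviation inequality from a bound for the Rademacher process. -/
lemma measureReal_deviation_le (D : Measure X) [IsProbabilityMeasure D] (ψ : A → X → ℝ)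
    (hψ : ∀ a, Measurable (ψ a)) (hb : ∀ a x, |ψ a x| ≤ 1) {lam s : ℝ} (hlam : 0 ≤ lam)
    (hs : ∀ x : Fin n → X, ∑ σ : Fin n → Bool,
      Real.exp (2 * lam * ⨆ a, signedSum σ fun i => ψ a (x i)) ≤ 2 ^ n * Real.exp s) (t : ℝ) :
    (Measure.pi fun _ : Fin n => D).real {x | ∃ a, t ≤ ∑ i, (∫ y, ψ a y ∂D - ψ a (x i))} ≤
      Real.exp (s - lam * t) := by
  set P : Measure (Fin n → X) := Measure.pi fun _ => D
  set Z : (Fin n → X) → ℝ := fun x =>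
    Real.exp (lam * ⨆ a, ∑ i, (∫ y, ψ a y ∂D - ψ a (x i)))
  have hint : Integrable Z P := by
    refine integrable_exp_iSup P hlam (B := n * 2) _ (fun a => ?_) fun a x => ?_
    · exact Finset.measurable_sum _ fun i _ =>
        ((hψ a).comp (measurable_pi_apply i)).const_sub _
    · refine (Finset.sum_le_sum (g := fun _ => (2 : ℝ)) fun i _ => ?_).trans (by simp)
      have h1 : ‖∫ y, ψ a y ∂D‖ ≤ 1 * D.real Set.univ :=
        norm_integral_le_of_norm_le_const (Filter.Eventually.of_forall fun y => hb a y)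
      rw [probReal_univ, mul_one, Real.norm_eq_abs] at h1
      linarith [(abs_le.1 h1).2, (abs_le.1 (hb a (x i))).1]
  have h1 := mul_meas_ge_le_integral_of_nonneg
    (Filter.Eventually.of_forall fun x => (Real.exp_pos _).le) hint (Real.exp (lam * t))
  have h2 := h1.trans (integral_exp_iSup_le D ψ hψ hb hlam hs)
  have h3 : P.real {x | ∃ a, t ≤ ∑ i, (∫ y, ψ a y ∂D - ψ a (x i))} ≤
      P.real {x | Real.exp (lam * t) ≤ Z x} := by
    refine measureReal_mono ?_
    rintro x ⟨a, ha⟩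
    exact Real.exp_le_exp.2 (mul_le_mul_of_nonneg_left (ha.trans
      (le_ciSup_finite (fun a => ∑ i, (∫ y, ψ a y ∂D - ψ a (x i))) a)) hlam)
  rw [Real.exp_sub, le_div_iff₀ (Real.exp_pos _), mul_comm]
  exact (mul_le_mul_of_nonneg_left h3 (Real.exp_pos _).le).trans h2

end Symmetrization

/-! ### The minimax theorem by separation of convex sets. -/

section Minimax

/-- Von Neumann's minimax theorem for finite games. -/
lemma exists_mixed_strategy {T A : Type*} [Fintype T] [Nonempty T] [Fintype A]
    (M : T → A → ℝ) (τ : ℝ)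
    (h : ∀ μ ∈ stdSimplex ℝ A, ∃ t, ∑ a, μ a * M t a ≤ τ) :
    ∃ w ∈ stdSimplex ℝ T, ∀ a, ∑ t, w t * M t a ≤ τ := by
  classical
  by_contra! hcon
  set L : (T → ℝ) →ₗ[ℝ] (A → ℝ) :=
    { toFun := fun w a => ∑ t, w t * M t a
      map_add' := fun v w => by
        ext a; simp [add_mul, Finset.sum_add_distrib]
      map_smul' := fun c w => by
        ext a; simp [mul_assoc, Finset.mul_sum] }
  have hLc : Continuous L := L.continuous_of_finiteDimensional
  have hdisj : Disjoint (L '' stdSimplex ℝ T) {v : A → ℝ | ∀ a, v a ≤ τ} := by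
    rw [Set.disjoint_left]
    rintro _ ⟨w, hw, rfl⟩ hv
    obtain ⟨a, ha⟩ := hcon w hw
    exact absurd (hv a) (not_le.2 ha)
  have hconv : Convex ℝ {v : A → ℝ | ∀ a, v a ≤ τ} := by
    intro x hx y hy p q hp hq hpq a
    have h1 := mul_le_mul_of_nonneg_left (hx a) hp
    have h2 := mul_le_mul_of_nonneg_left (hy a) hq
    have h3 : p * τ + q * τ = τ := by rw [← add_mul, hpq, one_mul]
    simp only [Pi.add_apply, Pi.smul_apply, smul_eq_mul]
    linarith
  have hclosed : IsClosed {v : A → ℝ | ∀ a, v a ≤ τ} := by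
    have : {v : A → ℝ | ∀ a, v a ≤ τ} = ⋂ a, {v | v a ≤ τ} := by ext; simp
    rw [this]
    exact isClosed_iInter fun a => isClosed_le (continuous_apply a) continuous_const
  obtain ⟨f, u, v, hu, huv, hv⟩ := geometric_hahn_banach_compact_closed
    ((convex_stdSimplex ℝ T).linear_image L) ((isCompact_stdSimplex ℝ T).image hLc)
    hconv hclosed hdisj
  set φ : A → ℝ := fun a => f (Pi.single a 1)
  have hf : ∀ x : A → ℝ, f x = ∑ a, x a * φ a := by
    intro x
    conv_lhs => rw [← Finset.univ_sum_single x]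
    rw [map_sum]
    refine Finset.sum_congr rfl fun a _ => ?_
    have : (Pi.single a (x a) : A → ℝ) = x a • Pi.single a 1 := by
      rw [← Pi.single_smul]; simp
    rw [this, map_smul, smul_eq_mul]
  -- The orthant is unbounded below, and `f` stays above `v` on it. Thus `-φ`, once normalized, is a
  -- mixed strategy of the opponent.
  have hφ : ∀ a, φ a ≤ 0 := by
    intro a
    by_contra! ha
    have h0 := hv (fun _ => τ) (fun _ => le_rfl)
    set s := (f (fun _ => τ) - v) / φ a
    have hs : 0 ≤ s := div_nonneg (by linarith) ha.le
    have h1 := hv ((fun _ => τ) - s • Pi.single a 1) (fun b => by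
      rcases eq_or_ne b a with rfl | hb
      · simpa using hs
      · simp [hb])
    rw [map_sub, map_smul, smul_eq_mul] at h1
    have h2 : s * φ a = f (fun _ => τ) - v := div_mul_cancel₀ _ ha.ne'
    change v < f (fun _ => τ) - s * φ a at h1
    linarith
  set N := ∑ a, -φ a
  have hN0 : 0 ≤ N := Finset.sum_nonneg fun a _ => neg_nonneg.2 (hφ a)
  have hfM : ∀ t, f (M t) < u := by
    intro t
    refine hu _ ⟨Pi.single t 1, single_mem_stdSimplex ℝ t, ?_⟩
    ext a
    simp [L, Pi.single_apply]
  have hτ : v < -(τ * N) := by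
    have := hv (fun _ => τ) (fun _ => le_rfl)
    rw [hf] at this
    simpa [N, Finset.mul_sum] using this
  rcases hN0.eq_or_lt with hN | hN
  · have hz : ∀ a, φ a = 0 := fun a => by
      have := (Finset.sum_eq_zero_iff_of_nonneg fun a _ => neg_nonneg.2 (hφ a)).1 hN.symm a
        (Finset.mem_univ a)
      linarith
    obtain ⟨t⟩ := ‹Nonempty T›
    have h1 := hfM t
    rw [hf] at h1
    simp only [hz, mul_zero, Finset.sum_const_zero] at h1
    rw [← hN] at hτ
    linarith
  · obtain ⟨t, ht⟩ := h (fun a => -φ a / N)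
      ⟨fun a => div_nonneg (neg_nonneg.2 (hφ a)) hN.le, by
        rw [← Finset.sum_div]; exact div_self hN.ne'⟩
    have h1 := hfM t
    have h2 : ∑ a, -φ a / N * M t a = -f (M t) / N := by
      rw [hf, ← Finset.sum_neg_distrib, Finset.sum_div]
      exact Finset.sum_congr rfl fun a _ => by ring
    rw [h2, div_le_iff₀ hN] at ht
    linarith

end Minimax

/-! ### Averages of independent draws from a finite distribution. -/

section Sampling

variable {A : Type*} [Fintype A]

lemma sum_fin_succ_fun {k : ℕ} (F : (Fin (k + 1) → A) → ℝ) :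
    ∑ t, F t = ∑ a, ∑ t : Fin k → A, F (Fin.cons a t) := by
  rw [← Fintype.sum_prod_type']
  exact (Equiv.sum_comp (Fin.consEquiv fun _ => A) F).symm

lemma sum_prod_weights (μ : A → ℝ) (hμ : ∑ a, μ a = 1) (k : ℕ) :
    ∑ t : Fin k → A, ∏ j, μ (t j) = 1 := by
  induction k with
  | zero => simp
  | succ k ih =>
    rw [sum_fin_succ_fun]
    simp [Fin.prod_univ_succ, ← Finset.mul_sum, ih, hμ]

lemma sum_prod_weights_mul_sum (μ h : A → ℝ) (hμ : ∑ a, μ a = 1) (hh : ∑ a, μ a * h a = 0)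
    (k : ℕ) : ∑ t : Fin k → A, (∏ j, μ (t j)) * ∑ j, h (t j) = 0 := by
  induction k with
  | zero => simp
  | succ k ih =>
    rw [sum_fin_succ_fun]
    have : ∀ a (t : Fin k → A), (∏ j, μ ((Fin.cons a t : Fin (k + 1) → A) j)) *
        ∑ j, h ((Fin.cons a t : Fin (k + 1) → A) j) =
        μ a * h a * ∏ j, μ (t j) + μ a * ((∏ j, μ (t j)) * ∑ j, h (t j)) := by
      intro a t
      simp only [Fin.prod_univ_succ, Fin.sum_univ_succ, Fin.cons_zero, Fin.cons_succ]
      ring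
    simp only [this, Finset.sum_add_distrib, ← Finset.mul_sum, ih, sum_prod_weights μ hμ]
    simp [hh]

lemma sum_prod_weights_mul_sum_sq (μ h : A → ℝ) (hμ : ∑ a, μ a = 1)
    (hh : ∑ a, μ a * h a = 0) (k : ℕ) :
    ∑ t : Fin k → A, (∏ j, μ (t j)) * (∑ j, h (t j)) ^ 2 = k * ∑ a, μ a * h a ^ 2 := by
  induction k with
  | zero => simp
  | succ k ih =>
    rw [sum_fin_succ_fun]
    have : ∀ a (t : Fin k → A), (∏ j, μ ((Fin.cons a t : Fin (k + 1) → A) j)) *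
        (∑ j, h ((Fin.cons a t : Fin (k + 1) → A) j)) ^ 2 =
        μ a * h a ^ 2 * ∏ j, μ (t j) + 2 * (μ a * h a) * ((∏ j, μ (t j)) * ∑ j, h (t j)) +
          μ a * ((∏ j, μ (t j)) * (∑ j, h (t j)) ^ 2) := by
      intro a t
      simp only [Fin.prod_univ_succ, Fin.sum_univ_succ, Fin.cons_zero, Fin.cons_succ]
      ring
    simp only [this, Finset.sum_add_distrib, ← Finset.mul_sum, ih, sum_prod_weights μ hμ,
      sum_prod_weights_mul_sum μ h hμ hh]
    simp only [mul_zero, Finset.sum_const_zero, add_zero, mul_one]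
    rw [← Finset.sum_mul, hμ]
    push_cast
    ring

/-- The mean absolute deviation of an average of `k` independent draws is at most `1 / √k`. -/
lemma sum_prod_weights_mul_abs_le (μ : A → ℝ) (hμ : μ ∈ stdSimplex ℝ A) (g : A → ℝ)
    (hg : ∀ a, g a ^ 2 ≤ 1) {k : ℕ} (hk : 0 < k) :
    ∑ t : Fin k → A, (∏ j, μ (t j)) * |(∑ j, g (t j)) / k - ∑ a, μ a * g a| ≤ 1 / √k := by
  obtain ⟨hμ0, hμ1⟩ := hμ
  have hk' : (0 : ℝ) < k := by exact_mod_cast hk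
  set m := ∑ a, μ a * g a
  have hh : ∑ a, μ a * (g a - m) = 0 := by
    simp only [mul_sub, Finset.sum_sub_distrib, ← Finset.sum_mul, hμ1]
    simp [m]
  have hV : ∑ a, μ a * (g a - m) ^ 2 ≤ 1 := by
    have e : ∑ a, μ a * (g a - m) ^ 2 = ∑ a, μ a * g a ^ 2 - m ^ 2 := by
      have : ∀ a, μ a * (g a - m) ^ 2 = μ a * g a ^ 2 - 2 * m * (μ a * g a) + μ a * m ^ 2 :=
        fun a => by ring
      simp only [this, Finset.sum_add_distrib, Finset.sum_sub_distrib, ← Finset.mul_sum,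
        ← Finset.sum_mul, hμ1]
      change _ - 2 * m * m + _ = _
      ring
    have : ∑ a, μ a * g a ^ 2 ≤ ∑ a, μ a :=
      Finset.sum_le_sum fun a _ => mul_le_of_le_one_right (hμ0 a) (hg a)
    nlinarith [sq_nonneg m]
  have hsq : 0 < √(k : ℝ) := Real.sqrt_pos.2 hk'
  have hss : √(k : ℝ) * √(k : ℝ) = k := Real.mul_self_sqrt hk'.le
  have hid : ∀ a r K : ℝ, 0 < r → r * r = K →
      a ^ 2 / (2 * K * r) + 1 / (2 * r) - a / K = (a - r) ^ 2 / (2 * K * r) := by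
    rintro a r K hr rfl
    field_simp
    ring
  -- AM–GM bounds the absolute value by a quadratic, so the second moment suffices.
  have hpt : ∀ t : Fin k → A, |(∑ j, g (t j)) / k - m| ≤
      (∑ j, (g (t j) - m)) ^ 2 / (2 * k * √k) + 1 / (2 * √k) := by
    intro t
    have e : (∑ j, g (t j)) / k - m = (∑ j, (g (t j) - m)) / k := by
      rw [Finset.sum_sub_distrib]; simp; field_simp
    rw [e, abs_div, abs_of_pos hk']
    set S := ∑ j, (g (t j) - m)
    rw [← sq_abs S]
    have : |S| ^ 2 / (2 * k * √k) + 1 / (2 * √k) - |S| / k =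
        (|S| - √k) ^ 2 / (2 * k * √k) := hid _ _ _ hsq hss
    have h2 : 0 ≤ (|S| - √k) ^ 2 / (2 * k * √(k : ℝ)) := by positivity
    linarith
  have hW : ∀ t : Fin k → A, 0 ≤ ∏ j, μ (t j) := fun t => Finset.prod_nonneg fun j _ => hμ0 _
  refine (Finset.sum_le_sum fun t _ => mul_le_mul_of_nonneg_left (hpt t) (hW t)).trans ?_
  simp only [mul_add, Finset.sum_add_distrib, sum_prod_weights μ hμ1,
    ← mul_div_assoc, ← Finset.sum_div, mul_one]
  rw [sum_prod_weights_mul_sum_sq μ (fun a => g a - m) hμ1 hh]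
  have h1 : (k : ℝ) * (∑ a, μ a * (g a - m) ^ 2) / (2 * k * √k) ≤ k * 1 / (2 * k * √k) := by
    gcongr
  have h2 : (k : ℝ) * 1 / (2 * k * √k) + 1 / (2 * √k) = 1 / √k := by field_simp; norm_num
  linarith

end Sampling

/-! ### Votes and their weights. -/

section TestFunctions

variable {X : Type*} {k : ℕ}

/-- The average of the signs `c j x`, a real number in `[-1, 1]`. -/
noncomputable def avgSgn (t : Fin k → X → Bool) (x : X) : ℝ := (∑ j, rsgn (t j x)) / k

/-- The weight of a point with label `b` and vote `q ∈ [-1, 1]`: it is `1` if the vote disagrees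
with the label and decreases to `1 / 2` as the vote tends to a unanimous agreement. -/
noncomputable def voteWeight (b : Bool) (q : ℝ) : ℝ := 1 / (1 + max (rsgn b * q) 0)

lemma voteWeight_nonneg (b : Bool) (q : ℝ) : 0 ≤ voteWeight b q := by
  unfold voteWeight; positivity

lemma voteWeight_le_one (b : Bool) (q : ℝ) : voteWeight b q ≤ 1 := by
  unfold voteWeight
  rw [div_le_one (by positivity)]
  linarith [le_max_right (rsgn b * q) 0]

lemma voteWeight_zero (b : Bool) : voteWeight b 0 = 1 := by simp [voteWeight]

lemma abs_voteWeight_sub_le (b : Bool) (p q : ℝ) :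
    |voteWeight b p - voteWeight b q| ≤ |p - q| := by
  have h1 : |max (rsgn b * q) 0 - max (rsgn b * p) 0| ≤ |p - q| := by
    refine (abs_max_sub_max_le_abs _ _ _).trans ?_
    rw [← mul_sub, abs_mul, abs_rsgn, one_mul, abs_sub_comm]
  unfold voteWeight
  set u := max (rsgn b * p) 0
  set v := max (rsgn b * q) 0
  have hu : 0 ≤ u := le_max_right _ _
  have hv : 0 ≤ v := le_max_right _ _
  have e : 1 / (1 + u) - 1 / (1 + v) = (v - u) / ((1 + u) * (1 + v)) := by
    field_simp; ring
  rw [e, abs_div, abs_of_pos (by positivity : 0 < (1 + u) * (1 + v))]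
  refine (div_le_self (abs_nonneg _) ?_).trans h1
  nlinarith [mul_nonneg hu hv]

/-- The first factor is the mass of the concepts with label `b` when the mean vote is `p`. At `q =
p` the weight caps the product at `1 / 2`. -/
lemma mul_voteWeight_le (b : Bool) (p q : ℝ) :
    (1 + rsgn b * p) / 2 * voteWeight b q ≤ 1 / 2 + |q - p| / 2 := by
  unfold voteWeight
  have h1 : rsgn b * p - rsgn b * q ≤ |q - p| := by
    rw [← mul_sub]
    refine (le_abs_self _).trans ?_
    rw [abs_mul, abs_rsgn, one_mul, abs_sub_comm]
  have h2 := le_max_left (rsgn b * q) 0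
  have h3 := le_max_right (rsgn b * q) 0
  rw [mul_one_div, div_le_iff₀ (by positivity)]
  nlinarith [mul_nonneg (abs_nonneg (q - p)) h3]

/-- When `b` agrees with the vote the maximum in the weight is `b q`, and at `q = p` the product is
exactly `1 / 2`. -/
lemma le_mul_voteWeight (b : Bool) (p q : ℝ) (hq : 0 ≤ rsgn b * q) :
    1 / 2 - |q - p| / 2 ≤ (1 + rsgn b * p) / 2 * voteWeight b q := by
  unfold voteWeight
  have h1 : rsgn b * q - rsgn b * p ≤ |q - p| := by
    rw [← mul_sub]
    refine (le_abs_self _).trans ?_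
    rw [abs_mul, abs_rsgn, one_mul]
  rw [max_eq_left hq, mul_one_div, le_div_iff₀ (by positivity)]
  nlinarith [mul_nonneg (abs_nonneg (q - p)) hq]

lemma rsgn_majority_mul_avgSgn_nonneg (t : Fin k → X → Bool) (x : X) :
    0 ≤ rsgn (majority t x) * avgSgn t x := by
  have e : ∑ j, rsgn (t j x) = ((∑ j, sgn (t j x) : ℤ) : ℝ) := by
    push_cast
    exact Finset.sum_congr rfl fun j _ => (sgn_cast _).symm
  unfold avgSgn majority
  rw [e]
  rcases le_or_gt 0 (∑ j, sgn (t j x)) with h | h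
  · have h' : (0 : ℝ) ≤ ((∑ j, sgn (t j x) : ℤ) : ℝ) := by exact_mod_cast h
    rw [decide_eq_true h, rsgn_true, one_mul]
    positivity
  · have h' : ((∑ j, sgn (t j x) : ℤ) : ℝ) ≤ 0 := by exact_mod_cast h.le
    rw [decide_eq_false (not_le.2 h), rsgn_false, neg_one_mul, ← neg_div]
    exact div_nonneg (by linarith) (by positivity)

lemma voteWeight_of_ne_majority (t : Fin k → X → Bool) (x : X) (b : Bool)
    (hb : majority t x ≠ b) : voteWeight b (avgSgn t x) = 1 := by
  have h := rsgn_majority_mul_avgSgn_nonneg t x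
  have hb' : b = !majority t x := by
    revert hb
    cases majority t x <;> cases b <;> simp
  unfold voteWeight
  rw [hb', rsgn_not, max_eq_right (by linarith)]
  simp

variable {A : Type*} [Fintype A]

lemma sum_mul_indicator_eq (μ : A → ℝ) (hμ : ∑ a, μ a = 1) (c : A → Bool) (b : Bool) (w : ℝ) :
    ∑ a, μ a * (if b = c a then w else 0) = (1 + rsgn b * ∑ a, μ a * rsgn (c a)) / 2 * w := by
  have h : ∀ a, μ a * (if b = c a then w else 0) =
      w / 2 * μ a + rsgn b * w / 2 * (μ a * rsgn (c a)) := by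
    intro a
    cases b <;> cases c a <;> simp <;> ring
  simp only [h, Finset.sum_add_distrib, ← Finset.mul_sum, hμ]
  ring

lemma sum_mul_label_weight_le (μ : A → ℝ) (hμ : ∑ a, μ a = 1) (c : A → Bool) (b : Bool) (q : ℝ) :
    ∑ a, μ a * (if b = c a then voteWeight b q else 0) ≤
      1 / 2 + |q - ∑ a, μ a * rsgn (c a)| / 2 := by
  rw [sum_mul_indicator_eq μ hμ]
  exact mul_voteWeight_le _ _ _

/-- A concept that disagrees with the majority has weight `1`, which cancels its error. Only the
weight at the majority label remains, and there the lower bound near `1 / 2` applies. -/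
lemma sum_mul_error_sub_weight_le (μ : A → ℝ) (hμ : ∑ a, μ a = 1) (c : A → X → Bool)
    (t : Fin k → X → Bool) (x : X) :
    ∑ a, μ a * ((if majority t x ≠ c a x then 1 else 0) - voteWeight (c a x) (avgSgn t x)) ≤
      -(1 / 2) + |avgSgn t x - ∑ a, μ a * rsgn (c a x)| / 2 := by
  have h : ∀ a, μ a * ((if majority t x ≠ c a x then 1 else 0) -
      voteWeight (c a x) (avgSgn t x)) =
      -(μ a * (if majority t x = c a x then voteWeight (majority t x) (avgSgn t x) else 0)) := by
    intro a
    by_cases hm : majority t x = c a x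
    · simp [hm]
    · simp [hm, voteWeight_of_ne_majority t x _ hm]
  simp only [h, Finset.sum_neg_distrib, sum_mul_indicator_eq μ hμ]
  linarith [le_mul_voteWeight (majority t x) (∑ a, μ a * rsgn (c a x)) (avgSgn t x)
    (rsgn_majority_mul_avgSgn_nonneg t x)]

end TestFunctions

/-! ### Measurability of votes and weights. -/

section Measurability

variable {X : Type*} [MeasurableSpace X] {k : ℕ}

lemma measurable_rsgn_comp {c : X → Bool} (hc : Measurable c) :
    Measurable fun x => rsgn (c x) :=
  (measurable_of_finite rsgn).comp hc

lemma measurable_avgSgn (t : Fin k → X → Bool) (ht : ∀ j, Measurable (t j)) :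
    Measurable (avgSgn t) :=
  (Finset.measurable_sum _ fun j _ => measurable_rsgn_comp (ht j)).div_const _

lemma measurable_majority (t : Fin k → X → Bool) (ht : ∀ j, Measurable (t j)) :
    Measurable (majority t) := by
  have h : Measurable fun x => ∑ j, sgn (t j x) :=
    Finset.measurable_sum _ fun j _ => (measurable_of_finite sgn).comp (ht j)
  exact (measurable_from_top (f := fun z : ℤ => decide (0 ≤ z))).comp h

lemma measurable_voteWeight_comp {c : X → Bool} (hc : Measurable c) {q : X → ℝ}
    (hq : Measurable q) : Measurable fun x => voteWeight (c x) (q x) :=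
  ((((measurable_rsgn_comp hc).mul hq).max measurable_const).const_add 1).const_div 1

lemma integrable_voteWeight_comp (D : Measure X) [IsFiniteMeasure D] {c : X → Bool}
    (hc : Measurable c) {q : X → ℝ} (hq : Measurable q) :
    Integrable (fun x => voteWeight (c x) (q x)) D :=
  Integrable.of_bound (measurable_voteWeight_comp hc hq).aestronglyMeasurable 1
    (Filter.Eventually.of_forall fun x => by
      rw [Real.norm_of_nonneg (voteWeight_nonneg _ _)]
      exact voteWeight_le_one _ _)

end Measurability

/-! ### Uniform convergence of the weights, with no dependence on `k`. -/

section Deviation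

variable {X : Type*} [MeasurableSpace X] {n k : ℕ}

omit [MeasurableSpace X] in
/-- The Rademacher process of the vote weights is dominated by that of the underlying class. -/
lemma sum_exp_iSup_voteWeight_le (hk : 0 < k) (C : Finset (X → Bool)) [Nonempty C]
    (c : X → Bool) (x : Fin n → X) {lam : ℝ} (hlam : 0 ≤ lam) :
    ∑ σ : Fin n → Bool, Real.exp (lam * ⨆ t : Fin k → C, signedSum σ fun i =>
        voteWeight (c (x i)) (avgSgn (fun j => (t j : X → Bool)) (x i)) - 1) ≤
      ∑ σ : Fin n → Bool,
        Real.exp (lam * ⨆ c : C, signedSum σ fun i => rsgn ((c : X → Bool) (x i))) := by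
  have hk' : (0 : ℝ) < k := by exact_mod_cast hk
  set q : (Fin k → C) → Fin n → ℝ := fun t i => avgSgn (fun j => (t j : X → Bool)) (x i)
  simp only [mul_ciSup_signedSum hlam]
  -- The shift by `1` makes the weight vanish at vote `0`, as contraction demands.
  refine (sum_exp_iSup_contraction _ (fun t => lam • q t) (fun t i => ?_) fun s t i => ?_).trans ?_
  · simp only [Pi.smul_apply, smul_eq_mul, abs_mul]
    refine mul_le_mul_of_nonneg_left ?_ (abs_nonneg _)
    have := abs_voteWeight_sub_le (c (x i)) (q t i) 0
    rwa [voteWeight_zero, sub_zero] at this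
  · simp only [Pi.smul_apply, smul_eq_mul, ← mul_sub, abs_mul, sub_sub_sub_cancel_right]
    exact mul_le_mul_of_nonneg_left (abs_voteWeight_sub_le _ _ _) (abs_nonneg _)
  · refine Finset.sum_le_sum fun σ _ => Real.exp_le_exp.2 ?_
    simp only [← mul_ciSup_signedSum hlam]
    refine mul_le_mul_of_nonneg_left (ciSup_le fun t => ?_) hlam
    have e : signedSum σ (q t) =
        (∑ j, signedSum σ fun i => rsgn ((t j : X → Bool) (x i))) / k := by
      simp only [signedSum, q, avgSgn, Finset.mul_sum, mul_div_assoc', Finset.sum_div]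
      exact Finset.sum_comm
    rw [e, div_le_iff₀ hk']
    refine (Finset.sum_le_sum fun j _ => le_ciSup_finite
      (fun c : C => signedSum σ fun i => rsgn ((c : X → Bool) (x i))) (t j)).trans_eq ?_
    simp [mul_comm]

/-- Uniform convergence of the vote weights over all `k`-tuples of a class of VC dimension `d`. -/
lemma measureReal_voteWeight_deviation_le (hn : 0 < n) (hk : 0 < k) (D : Measure X)
    [IsProbabilityMeasure D] (C : Finset (X → Bool)) [Nonempty C] (hC : ∀ c ∈ C, Measurable c)
    (d : ℕ) (hd0 : 1 ≤ d) (hd : ∀ T : Finset X, Shatters (C : Set (X → Bool)) T → T.card ≤ d)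
    (c : X → Bool) (hc : Measurable c) {τ : ℝ} (hτ : 0 ≤ τ) :
    (Measure.pi fun _ : Fin n => D).real {x | ∃ t : Fin k → C, n * τ ≤
      ∑ i, (∫ y, voteWeight (c y) (avgSgn (fun j => (t j : X → Bool)) y) ∂D -
        voteWeight (c (x i)) (avgSgn (fun j => (t j : X → Bool)) (x i)))} ≤
      Real.exp (12 * d - n * τ ^ 2 / 656) := by
  have hq : ∀ t : Fin k → C, Measurable (avgSgn fun j => (t j : X → Bool)) := fun t =>
    measurable_avgSgn _ fun j => hC _ (t j).2
  -- This minimizes `164 n lam ^ 2 - lam n τ`, with value `-n τ ^ 2 / 656`.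
  set lam := τ / 328
  have hlam : 0 ≤ lam := by positivity
  have key := measureReal_deviation_le (n := n) D
    (fun (t : Fin k → C) y => voteWeight (c y) (avgSgn (fun j => (t j : X → Bool)) y) - 1)
    (fun t => (measurable_voteWeight_comp hc (hq t)).sub_const 1)
    (fun t y => by
      rw [abs_le]
      constructor <;> linarith [voteWeight_nonneg (c y) (avgSgn (fun j => (t j : X → Bool)) y),
        voteWeight_le_one (c y) (avgSgn (fun j => (t j : X → Bool)) y)])
    hlam (s := 12 * d + 41 * n * (2 * lam) ^ 2)
    (fun x => (sum_exp_iSup_voteWeight_le hk C c x (by positivity)).trans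
      (sum_exp_iSup_le_of_vc hn C hC d hd0 hd x (2 * lam) (by positivity))) (n * τ)
  have e : 12 * (d : ℝ) + 41 * n * (2 * lam) ^ 2 - lam * (n * τ) = 12 * d - n * τ ^ 2 / 656 := by
    simp only [lam]; ring
  rw [e] at key
  refine le_trans (le_of_eq ?_) key
  congr 1
  ext x
  refine exists_congr fun t => ?_
  rw [integral_sub (integrable_voteWeight_comp D hc (hq t)) (integrable_const _)]
  simp

end Deviation

/-! ### The game between majorities and concepts. -/

section Game

variable {X : Type*} [MeasurableSpace X] {n k : ℕ}

/-- How much the dataset `S` refutes the target `c` by means of the vote weights of the tuple `t`: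
the expected weight of a clean labeled point minus the weight observed on the points of `S` that
are consistent with `c`. -/
noncomputable def refutation (D : Measure X) (S : Fin n → X × Bool) (c : X → Bool)
    (t : Fin k → X → Bool) : ℝ :=
  ∫ y, voteWeight (c y) (avgSgn t y) ∂D -
    (∑ i, if (S i).2 = c (S i).1 then voteWeight (S i).2 (avgSgn t (S i).1) else 0) / n

/-- The `-1 / 2` from the distribution cancels the `1 / 2` from the dataset. The bound on the
dataset term holds at every labeled point, so nothing is asked of `S`. -/
lemma sum_mul_error_sub_refutation_le (hn : 0 < n) (D : Measure X) [IsProbabilityMeasure D]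
    (S : Fin n → X × Bool) {A : Type*} [Fintype A] (μ : A → ℝ) (hμ : ∑ a, μ a = 1)
    (c : A → X → Bool) (hc : ∀ a, Measurable (c a)) (t : Fin k → X → Bool)
    (ht : ∀ j, Measurable (t j)) :
    ∑ a, μ a * (D.real {x | majority t x ≠ c a x} - refutation D S (c a) t) ≤
      (∫ y, |avgSgn t y - ∑ a, μ a * rsgn (c a y)| ∂D) / 2 +
        (∑ i, |avgSgn t (S i).1 - ∑ a, μ a * rsgn (c a (S i).1)|) / n / 2 := by
  have hn' : (0 : ℝ) < n := by exact_mod_cast hn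
  set e : X → ℝ := fun y => |avgSgn t y - ∑ a, μ a * rsgn (c a y)|
  have hq := measurable_avgSgn t ht
  have hm := measurable_majority t ht
  have hset : ∀ a, MeasurableSet {x | majority t x ≠ c a x} := fun a =>
    (measurableSet_eq_fun hm (hc a)).compl
  have hfun : ∀ a, (fun x => if majority t x ≠ c a x then (1 : ℝ) else 0) =
      {x | majority t x ≠ c a x}.indicator 1 := by
    intro a
    ext x
    by_cases h : majority t x ≠ c a x <;> simp [Set.indicator, h]
  have hind : ∀ a, Integrable (fun x => if majority t x ≠ c a x then (1 : ℝ) else 0) D := fun a => by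
    rw [hfun]
    exact (integrable_const (1 : ℝ)).indicator (hset a)
  have hvw : ∀ a, Integrable (fun x => voteWeight (c a x) (avgSgn t x)) D := fun a =>
    integrable_voteWeight_comp D (hc a) hq
  have hreal : ∀ a, D.real {x | majority t x ≠ c a x} =
      ∫ x, (if majority t x ≠ c a x then (1 : ℝ) else 0) ∂D := fun a => by
    rw [hfun]
    exact (integral_indicator_one (hset a)).symm
  have hei : Integrable e D := by
    refine Integrable.abs (Integrable.sub ?_ ?_)
    · exact Integrable.div_const (integrable_finsetSum _ fun j _ =>
        Integrable.of_bound (measurable_rsgn_comp (ht j)).aestronglyMeasurable 1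
          (Filter.Eventually.of_forall fun x => (abs_rsgn _).le)) _
    · exact integrable_finsetSum _ fun a _ => (Integrable.of_bound
        (measurable_rsgn_comp (hc a)).aestronglyMeasurable 1
          (Filter.Eventually.of_forall fun x => (abs_rsgn _).le)).const_mul _
  have hsub : ∀ a, Integrable (fun x => (if majority t x ≠ c a x then (1 : ℝ) else 0) -
      voteWeight (c a x) (avgSgn t x)) D := fun a => (hind a).sub (hvw a)
  have h1 : ∑ a, μ a * (D.real {x | majority t x ≠ c a x} -
      ∫ y, voteWeight (c a y) (avgSgn t y) ∂D) ≤ -(1 / 2) + (∫ y, e y ∂D) / 2 := by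
    have h : ∑ a, μ a * (D.real {x | majority t x ≠ c a x} -
        ∫ y, voteWeight (c a y) (avgSgn t y) ∂D) =
        ∫ x, ∑ a, μ a * ((if majority t x ≠ c a x then (1 : ℝ) else 0) -
          voteWeight (c a x) (avgSgn t x)) ∂D := by
      rw [integral_finsetSum _ fun a _ => (hsub a).const_mul (μ a)]
      refine Finset.sum_congr rfl fun a _ => ?_
      rw [integral_const_mul, integral_sub (hind a) (hvw a), hreal]
    have h2 : ∫ x, (-(1 / 2) + e x / 2) ∂D = -(1 / 2) + (∫ y, e y ∂D) / 2 := by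
      rw [integral_add (integrable_const _) (hei.div_const 2), integral_div]
      simp
    rw [h, ← h2]
    exact integral_mono (integrable_finsetSum _ fun a _ =>
      (hsub a).const_mul (μ a)) ((integrable_const _).add (hei.div_const 2))
      fun x => sum_mul_error_sub_weight_le μ hμ c t x
  have h2 : ∑ a, μ a * ((∑ i, if (S i).2 = c a (S i).1 then
      voteWeight (S i).2 (avgSgn t (S i).1) else 0) / n) ≤ 1 / 2 + (∑ i, e (S i).1) / n / 2 := by
    have h : ∑ a, μ a * ((∑ i, if (S i).2 = c a (S i).1 then
        voteWeight (S i).2 (avgSgn t (S i).1) else 0) / n) =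
        (∑ i, ∑ a, μ a * (if (S i).2 = c a (S i).1 then
          voteWeight (S i).2 (avgSgn t (S i).1) else 0)) / n := by
      rw [Finset.sum_comm, Finset.sum_div]
      refine Finset.sum_congr rfl fun a _ => ?_
      rw [← Finset.mul_sum, mul_div_assoc]
    have h3 : ∑ i, ∑ a, μ a * (if (S i).2 = c a (S i).1 then
          voteWeight (S i).2 (avgSgn t (S i).1) else 0) ≤ ∑ i, (1 / 2 + e (S i).1 / 2) :=
      Finset.sum_le_sum fun i _ =>
        sum_mul_label_weight_le μ hμ (fun a => c a (S i).1) (S i).2 (avgSgn t (S i).1)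
    rw [h, div_le_iff₀ hn']
    refine h3.trans_eq ?_
    rw [Finset.sum_add_distrib, ← Finset.sum_div Finset.univ fun i => e (S i).1]
    simp
    field_simp
  have h3 : ∑ a, μ a * (D.real {x | majority t x ≠ c a x} - refutation D S (c a) t) =
      ∑ a, μ a * (D.real {x | majority t x ≠ c a x} -
        ∫ y, voteWeight (c a y) (avgSgn t y) ∂D) +
      ∑ a, μ a * ((∑ i, if (S i).2 = c a (S i).1 then
        voteWeight (S i).2 (avgSgn t (S i).1) else 0) / n) := by
    rw [← Finset.sum_add_distrib]
    refine Finset.sum_congr rfl fun a _ => ?_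
    unfold refutation
    ring
  rw [h3]
  linarith

/-- For every dataset some mixture of majorities has an error with respect to each concept that
exceeds the refutation of this concept by at most `1 / √k`. -/
lemma exists_mixture_of_majorities (hn : 0 < n) (hk : 0 < k) (D : Measure X)
    [IsProbabilityMeasure D] (C : Finset (X → Bool)) [Nonempty C] (hC : ∀ c ∈ C, Measurable c)
    (S : Fin n → X × Bool) :
    ∃ w ∈ stdSimplex ℝ (Fin k → C), ∀ c : C,
      ∑ t, w t * D.real {x | majority (fun j => (t j : X → Bool)) x ≠ (c : X → Bool) x} ≤
        (⨆ t : Fin k → C, refutation D S c fun j => (t j : X → Bool)) + 1 / √k := by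
  set R : C → ℝ := fun c => ⨆ t : Fin k → C, refutation D S c fun j => (t j : X → Bool)
  set E : (Fin k → C) → C → ℝ := fun t c =>
    D.real {x | majority (fun j => (t j : X → Bool)) x ≠ (c : X → Bool) x}
  suffices H : ∀ μ ∈ stdSimplex ℝ C, ∃ t, ∑ c, μ c * (E t c - R c) ≤ 1 / √(k : ℝ) by
    obtain ⟨w, hw, h⟩ := exists_mixed_strategy (fun t c => E t c - R c) (1 / √(k : ℝ)) H
    refine ⟨w, hw, fun c => ?_⟩
    have := h c
    simp only [mul_sub, Finset.sum_sub_distrib, ← Finset.sum_mul, hw.2, one_mul] at this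
    linarith
  intro μ hμ
  have hn' : (0 : ℝ) < n := by exact_mod_cast hn
  set e : (Fin k → C) → X → ℝ := fun t y =>
    |avgSgn (fun j => (t j : X → Bool)) y - ∑ a : C, μ a * rsgn ((a : X → Bool) y)|
  set G : (Fin k → C) → ℝ := fun t => ∑ c, μ c * (E t c - R c)
  have hG : ∀ t, G t ≤ (∫ y, e t y ∂D) / 2 + (∑ i, e t (S i).1) / n / 2 := by
    intro t
    refine (Finset.sum_le_sum fun c _ => mul_le_mul_of_nonneg_left ?_ (hμ.1 c)).trans
      (sum_mul_error_sub_refutation_le hn D S μ hμ.2 (fun c : C => (c : X → Bool))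
        (fun c => hC c c.2) (fun j => (t j : X → Bool)) fun j => hC _ (t j).2)
    exact sub_le_sub_left (le_ciSup_finite
      (fun t : Fin k → C => refutation D S c fun j => (t j : X → Bool)) t) _
  -- The law of `k` independent draws from `μ`; the best tuple is at least as good as the average
  -- one.
  set W : (Fin k → C) → ℝ := fun t => ∏ j, μ (t j)
  have hW0 : ∀ t, 0 ≤ W t := fun t => Finset.prod_nonneg fun j _ => hμ.1 _
  have hW1 : ∑ t, W t = 1 := sum_prod_weights μ hμ.2 k
  have hWe : ∀ y, ∑ t, W t * e t y ≤ 1 / √k := fun y =>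
    sum_prod_weights_mul_abs_le μ hμ (fun a : C => rsgn ((a : X → Bool) y))
      (fun a => (rsgn_sq _).le) hk
  have hei : ∀ t, Integrable (e t) D := by
    intro t
    refine Integrable.abs (Integrable.sub ?_ ?_)
    · exact Integrable.div_const (integrable_finsetSum _ fun j _ =>
        Integrable.of_bound (measurable_rsgn_comp (hC _ (t j).2)).aestronglyMeasurable 1
          (Filter.Eventually.of_forall fun x => (abs_rsgn _).le)) _
    · exact integrable_finsetSum _ fun a _ => (Integrable.of_bound
        (measurable_rsgn_comp (hC a a.2)).aestronglyMeasurable 1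
          (Filter.Eventually.of_forall fun x => (abs_rsgn _).le)).const_mul _
  have hD : ∑ t, W t * ∫ y, e t y ∂D ≤ 1 / √k := by
    simp only [← integral_const_mul]
    rw [← integral_finsetSum _ fun t _ => (hei t).const_mul (W t)]
    refine (integral_mono (integrable_finsetSum _ fun t _ => (hei t).const_mul (W t))
      (integrable_const (1 / √(k : ℝ))) hWe).trans_eq (by simp)
  have hS : ∑ t, W t * ((∑ i, e t (S i).1) / n) ≤ 1 / √k := by
    simp only [← mul_div_assoc, ← Finset.sum_div, Finset.mul_sum]
    rw [Finset.sum_comm, div_le_iff₀ hn']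
    refine (Finset.sum_le_sum fun i _ => hWe (S i).1).trans_eq ?_
    simp
    ring_nf
  obtain ⟨t, ht⟩ := Finite.exists_min G
  refine ⟨t, ?_⟩
  change G t ≤ _
  calc G t = ∑ s, W s * G t := by rw [← Finset.sum_mul, hW1, one_mul]
    _ ≤ ∑ s, W s * ((∫ y, e s y ∂D) / 2 + (∑ i, e s (S i).1) / n / 2) :=
        Finset.sum_le_sum fun s _ => mul_le_mul_of_nonneg_left ((ht s).trans (hG s)) (hW0 s)
    _ = (∑ s, W s * ∫ y, e s y ∂D) / 2 + (∑ s, W s * ((∑ i, e s (S i).1) / n)) / 2 := by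
        rw [Finset.sum_div, Finset.sum_div, ← Finset.sum_add_distrib]
        exact Finset.sum_congr rfl fun s _ => by ring
    _ ≤ _ := by linarith

/-- If `S` is obtained from the clean sample `x` by changing the entries in `J`, and the vote
weights are well estimated on `x`, then the true target is not refuted much. -/
lemma refutation_le (hn : 0 < n) (D : Measure X) (S : Fin n → X × Bool) (c : X → Bool)
    (t : Fin k → X → Bool) (x : Fin n → X) (J : Finset (Fin n))
    (hJ : ∀ i, i ∉ J → S i = (x i, c (x i))) {τ : ℝ}
    (hx : ∑ i, (∫ y, voteWeight (c y) (avgSgn t y) ∂D -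
      voteWeight (c (x i)) (avgSgn t (x i))) ≤ n * τ) :
    refutation D S c t ≤ J.card / n + τ := by
  have hn' : (0 : ℝ) < n := by exact_mod_cast hn
  have h1 : ∑ i, voteWeight (c (x i)) (avgSgn t (x i)) - J.card ≤
      ∑ i, if (S i).2 = c (S i).1 then voteWeight (S i).2 (avgSgn t (S i).1) else 0 := by
    have h : (J.card : ℝ) = ∑ i, if i ∈ J then (1 : ℝ) else 0 := by simp
    rw [h, ← Finset.sum_sub_distrib]
    refine Finset.sum_le_sum fun i _ => ?_
    by_cases hi : i ∈ J
    · rw [if_pos hi]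
      have h2 := voteWeight_le_one (c (x i)) (avgSgn t (x i))
      have h3 := voteWeight_nonneg (S i).2 (avgSgn t (S i).1)
      split_ifs <;> linarith
    · rw [if_neg hi, hJ i hi]
      simp
  rw [Finset.sum_sub_distrib] at hx
  simp only [Finset.sum_const, Finset.card_univ, Fintype.card_fin, nsmul_eq_mul] at hx
  unfold refutation
  rw [sub_le_iff_le_add, ← sub_le_iff_le_add', ← mul_le_mul_iff_right₀ hn']
  have h2 : (n : ℝ) * ((∑ i, if (S i).2 = c (S i).1 then
      voteWeight (S i).2 (avgSgn t (S i).1) else 0) / n) = ∑ i, if (S i).2 = c (S i).1 then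
      voteWeight (S i).2 (avgSgn t (S i).1) else 0 := by field_simp
  have h3 : (n : ℝ) * (J.card / n) = J.card := by field_simp
  rw [h2, mul_sub, mul_add, h3]
  linarith

end Game

/-! ### The binomial tail. -/

section Binomial

lemma integral_exp_binomial (n : ℕ) (p : unitInterval) (lam : ℝ) :
    ∫ j : ℕ, Real.exp (lam * j) ∂(binomial n p) = ((p : ℝ) * Real.exp lam + (1 - p)) ^ n := by
  rw [integral_binomial, add_pow]
  have : Finset.Iic n = Finset.range (n + 1) := by
    ext; simp
  rw [this]
  refine Finset.sum_congr rfl fun k _ => ?_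
  rw [mul_pow, ← Real.exp_nat_mul, smul_eq_mul, mul_comm lam]
  ring

/-- The Chernoff bound for the upper tail of the binomial distribution. -/
lemma binomial_real_tail_le (n : ℕ) (p : unitInterval) {τ : ℝ} (hτ : 0 ≤ τ) (hτ1 : τ ≤ 1) :
    (binomial n p).real {j : ℕ | ((p : ℝ) + τ) * n ≤ j} ≤ Real.exp (-(n * τ ^ 2 / 4)) := by
  set lam := τ / 2
  have hlam : 0 ≤ lam := by positivity
  have h1 := mul_meas_ge_le_integral_of_nonneg (μ := binomial n p)
    (f := fun j : ℕ => Real.exp (lam * j))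
    (Filter.Eventually.of_forall fun j => (Real.exp_pos _).le) (integrable_binomial _)
    (Real.exp (lam * (((p : ℝ) + τ) * n)))
  have hset : {j : ℕ | Real.exp (lam * (((p : ℝ) + τ) * n)) ≤ Real.exp (lam * j)} ⊇
      {j : ℕ | ((p : ℝ) + τ) * n ≤ j} := fun j hj =>
    Real.exp_le_exp.2 (mul_le_mul_of_nonneg_left hj hlam)
  -- From `exp lam ≤ 1 + lam + lam ^ 2`; the choice `lam = τ / 2` then minimizes `lam ^ 2 - lam τ`.
  have h2 : (p : ℝ) * Real.exp lam + (1 - p) ≤ Real.exp (lam * p + lam ^ 2) := by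
    have e1 := Real.abs_exp_sub_one_sub_id_le (x := lam)
      (by rw [abs_of_nonneg hlam]; simp only [lam]; linarith)
    have e2 := (abs_le.1 e1).2
    have hp0 := p.2.1
    have hp1 := p.2.2
    have e3 := Real.add_one_le_exp (lam * p + lam ^ 2)
    nlinarith [sq_nonneg lam]
  have h3 : ((p : ℝ) * Real.exp lam + (1 - p)) ^ n ≤ Real.exp (n * (lam * p + lam ^ 2)) := by
    rw [Real.exp_nat_mul]
    have hp0 := p.2.1
    have hp1 := p.2.2
    have : 0 ≤ 1 - (p : ℝ) := by linarith
    exact pow_le_pow_left₀ (by positivity) h2 n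
  rw [integral_exp_binomial] at h1
  have h4 : Real.exp (-(n * τ ^ 2 / 4)) = Real.exp (n * (lam * p + lam ^ 2)) /
      Real.exp (lam * (((p : ℝ) + τ) * n)) := by
    rw [← Real.exp_sub]
    congr 1
    simp only [lam]
    ring
  rw [h4, le_div_iff₀ (Real.exp_pos _), mul_comm]
  exact (mul_le_mul_of_nonneg_left (measureReal_mono hset) (Real.exp_pos _).le).trans
    (h1.trans h3)

end Binomial

/-! ### From the game to the learner. -/

section Learner

variable {X : Type u} [MeasurableSpace X]

lemma error_map {T : Type*} [Fintype T] (D : Measure X) (p : PMF T) (f : T → X → Bool)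
    (c : X → Bool) : error D (p.map f) c = ∑ t, p t * D {x | f t x ≠ c x} := by
  classical
  unfold error
  simp only [PMF.map_apply, tsum_fintype, Finset.sum_mul]
  rw [Summable.tsum_finsetSum fun _ _ => ENNReal.summable]
  refine Finset.sum_congr rfl fun t _ => ?_
  rw [tsum_eq_single (f t) fun g hg => by simp [hg]]
  simp

lemma error_pure (D : Measure X) (g c : X → Bool) :
    error D (PMF.pure g) c = D {x | g x ≠ c x} := by
  have := error_map D (PMF.pure ()) (fun _ => g) c
  rw [PMF.pure_map] at this
  simpa using this

omit [MeasurableSpace X] in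
lemma majority_const {k : ℕ} (hk : 0 < k) (c : X → Bool) :
    majority (fun _ : Fin k => c) = c := by
  ext x
  cases h : c x
  · simp [majority, sgn, h, hk.ne']
  · simp [majority, sgn, h]

/-- The probability mass function given by a point of the standard simplex. -/
noncomputable def simplexPMF {T : Type*} [Fintype T] (w : T → ℝ) (hw : w ∈ stdSimplex ℝ T) :
    PMF T :=
  PMF.ofFintype (fun t => ENNReal.ofReal (w t)) (by
    rw [← ENNReal.ofReal_sum_of_nonneg fun t _ => hw.1 t, hw.2, ENNReal.ofReal_one])

lemma error_simplexPMF_map {T : Type*} [Fintype T] (D : Measure X) [IsProbabilityMeasure D]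
    (w : T → ℝ) (hw : w ∈ stdSimplex ℝ T) (f : T → X → Bool) (c : X → Bool) :
    error D ((simplexPMF w hw).map f) c =
      ENNReal.ofReal (∑ t, w t * D.real {x | f t x ≠ c x}) := by
  rw [error_map, ENNReal.ofReal_sum_of_nonneg fun t _ => mul_nonneg (hw.1 t) measureReal_nonneg]
  refine Finset.sum_congr rfl fun t _ => ?_
  rw [ENNReal.ofReal_mul (hw.1 t), ofReal_measureReal]
  rfl

lemma measureReal_ne_triangle (D : Measure X) [IsProbabilityMeasure D] (f g h : X → Bool) :
    D.real {x | f x ≠ h x} ≤ D.real {x | f x ≠ g x} + D.real {x | h x ≠ g x} := by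
  refine (measureReal_mono (fun x hx => ?_)).trans (measureReal_union_le _ _)
  by_contra hcon
  simp only [Set.mem_union, Set.mem_ofPred_eq, not_or, not_not] at hcon hx
  exact hx (hcon.1.trans hcon.2.symm)

lemma measure_pi_exists_ne_le {n : ℕ} (D : Measure X) [IsProbabilityMeasure D] (c c' : X → Bool)
    {γ : ℝ} (h : D.real {x | c x ≠ c' x} ≤ γ) :
    (Measure.pi fun _ : Fin n => D) {x | ∃ i, c (x i) ≠ c' (x i)} ≤ ENNReal.ofReal (n * γ) := by
  have e : {x : Fin n → X | ∃ i, c (x i) ≠ c' (x i)} =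
      ⋃ i, Function.eval i ⁻¹' {y | c y ≠ c' y} := by
    ext; simp
  rw [e]
  refine (measure_iUnion_fintype_le _ _).trans ?_
  have h1 : ∀ i : Fin n, (Measure.pi fun _ : Fin n => D)
      (Function.eval i ⁻¹' {y | c y ≠ c' y}) ≤ ENNReal.ofReal γ := by
    intro i
    have hmp := measurePreserving_eval (fun _ : Fin n => D) i
    refine (Measure.le_map_apply hmp.measurable.aemeasurable _).trans ?_
    rw [hmp.map_eq, ← ofReal_measureReal]
    exact ENNReal.ofReal_le_ofReal h
  refine (Finset.sum_le_sum fun i _ => h1 i).trans_eq ?_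
  rw [Finset.sum_const, Finset.card_univ, Fintype.card_fin, nsmul_eq_mul,
    ENNReal.ofReal_mul (by positivity), ENNReal.ofReal_natCast]

omit [MeasurableSpace X] in
lemma card_le_of_vcDim_eq {C : Set (X → Bool)} {d : ℕ} (hvc : vcDim C = (d : ℕ∞)) (T : Finset X)
    (hT : Shatters C T) : T.card ≤ d := by
  have : (T.card : ℕ∞) ≤ vcDim C := le_iSup₂ (f := fun (T : Finset X) (_ : Shatters C T) =>
    (T.card : ℕ∞)) T hT
  rw [hvc] at this
  exact_mod_cast this

omit [MeasurableSpace X] in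
lemma eq_of_vcDim_eq_zero {C : Set (X → Bool)} (hvc : vcDim C = ((0 : ℕ) : ℕ∞)) {c c' : X → Bool}
    (hc : c ∈ C) (hc' : c' ∈ C) : c = c' := by
  by_contra hne
  obtain ⟨x, hx⟩ := Function.ne_iff.1 hne
  have := card_le_of_vcDim_eq hvc {x} fun y => by
    by_cases h : c x = y x
    · exact ⟨c, hc, by simpa using h⟩
    · refine ⟨c', hc', ?_⟩
      simp only [Finset.mem_singleton, forall_eq]
      revert hx h
      cases c x <;> cases c' x <;> cases y x <;> simp
  simp at this

/-- The learner that always outputs a concept `c₀` within error `e` of all members of `C`. -/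
lemma exists_learner_of_error_le {C : Set (X → Bool)} (D : Measure X) (n : ℕ) {k : ℕ} (hk : 0 < k)
    {ε : ℝ} (δ : ℝ) {c₀ : X → Bool} (hc₀ : c₀ ∈ C)
    (h : ∀ c ∈ C, D {x | c₀ x ≠ c x} ≤ ENNReal.ofReal ε) :
    ∃ A : (Fin n → X × Bool) → PMF (X → Bool),
      (∀ S, (A S).support ⊆ Maj k C) ∧
      ∀ η : unitInterval, LearnsWithNastyNoise.{u, v} C D η ((η : ℝ) + ε) δ A := by
  refine ⟨fun _ => PMF.pure c₀, fun _ => ?_, fun η c hc Ω _ P _ x J S _ => ?_⟩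
  · rw [PMF.support_pure, Set.singleton_subset_iff]
    exact ⟨fun _ => c₀, fun _ => hc₀, (majority_const hk c₀).symm⟩
  · have : {ω : Ω | ENNReal.ofReal ((η : ℝ) + ε) < error D (PMF.pure c₀) c} = ∅ := by
      ext ω
      simp only [Set.mem_ofPred_eq, Set.mem_empty_iff_false, iff_false, not_lt, error_pure]
      refine (h c hc).trans (ENNReal.ofReal_le_ofReal ?_)
      linarith [η.2.1]
    rw [this, measure_empty]
    exact zero_le

/-- The learner obtained from the game of `exists_mixture_of_majorities`, for a finite class `N`
that is a `γ`-net of `C`. -/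
lemma exists_learner_of_net (C : Set (X → Bool)) (hC : ∀ c ∈ C, Measurable c) (D : Measure X)
    [IsProbabilityMeasure D] (d : ℕ) (hd0 : 1 ≤ d)
    (hd : ∀ T : Finset X, Shatters C T → T.card ≤ d) {n k : ℕ} (hn : 0 < n) (hk : 0 < k)
    {τ γ δ₁ : ℝ} (hτ : 0 ≤ τ) (hτ1 : τ ≤ 1) (hkτ : 1 / √(k : ℝ) ≤ τ) (hγτ : γ ≤ τ)
    (hγδ : n * γ ≤ δ₁) (hdev : Real.exp (12 * d - n * τ ^ 2 / 656) ≤ δ₁)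
    (htail : Real.exp (-(n * τ ^ 2 / 4)) ≤ δ₁)
    (N : Finset (X → Bool)) [Nonempty N] (hN : (N : Set (X → Bool)) ⊆ C)
    (hnet : ∀ c ∈ C, ∃ c' ∈ N, D.real {x | c x ≠ c' x} ≤ γ) :
    ∃ A : (Fin n → X × Bool) → PMF (X → Bool),
      (∀ S, (A S).support ⊆ Maj k C) ∧
      ∀ η : unitInterval, LearnsWithNastyNoise.{u, v} C D η ((η : ℝ) + 4 * τ) (3 * δ₁) A := by
  have hn' : (0 : ℝ) < n := by exact_mod_cast hn
  have hNm : ∀ c ∈ N, Measurable c := fun c hc => hC c (hN hc)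
  choose w hw hwerr using fun S => exists_mixture_of_majorities (n := n) hn hk D N hNm S
  set maj : (Fin k → N) → X → Bool := fun t => majority fun j => (t j : X → Bool)
  refine ⟨fun S => (simplexPMF (w S) (hw S)).map maj, fun S g hg => ?_, ?_⟩
  · obtain ⟨t, -, rfl⟩ := (PMF.mem_support_map_iff _ _ _).1 hg
    exact ⟨fun j => t j, fun j => hN (t j).2, rfl⟩
  intro η c hc Ω _ P _ x J S hS
  obtain ⟨c', hc', hcc'⟩ := hnet c hc
  -- Off `B₁` the clean sample is also labeled by the net element `c'`, so `c'` may act as target.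
  -- The four `τ` pay for the deviation, the binomial fluctuation, `1 / √k`, and the passage from
  -- `c'` back to `c`.
  set B₁ : Set (Fin n → X) := {x | ∃ i, c (x i) ≠ c' (x i)}
  set B₂ : Set (Fin n → X) := {x | ∃ t : Fin k → N, n * τ ≤
    ∑ i, (∫ y, voteWeight (c' y) (avgSgn (fun j => (t j : X → Bool)) y) ∂D -
      voteWeight (c' (x i)) (avgSgn (fun j => (t j : X → Bool)) (x i)))}
  set B₃ : Set ℕ := {j : ℕ | ((η : ℝ) + τ) * n ≤ j}
  have hsub : {ω | ENNReal.ofReal ((η : ℝ) + 4 * τ) <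
      error D ((simplexPMF (w (S ω)) (hw (S ω))).map maj) c} ⊆
      x ⁻¹' B₁ ∪ x ⁻¹' B₂ ∪ (fun ω => (J ω).card) ⁻¹' B₃ := by
    intro ω hω
    by_contra hgood
    simp only [Set.mem_union, Set.mem_preimage, not_or, B₁, B₂, B₃, Set.mem_ofPred_eq,
      not_exists, not_not, not_le] at hgood
    obtain ⟨⟨h1, h2⟩, h3⟩ := hgood
    refine not_le.2 (Set.mem_ofPred_eq ▸ hω) ?_
    rw [error_simplexPMF_map]
    refine ENNReal.ofReal_le_ofReal ?_
    have hR : (⨆ t : Fin k → N, refutation D (S ω) c' fun j => (t j : X → Bool)) ≤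
        (J ω).card / n + τ := ciSup_le fun t =>
      refutation_le hn D (S ω) c' _ (x ω) (J ω)
        (fun i hi => by rw [hS.agree ω i hi, h1 i]) (h2 t).le
    have hJ : ((J ω).card : ℝ) / n ≤ (η : ℝ) + τ := by
      rw [div_le_iff₀ hn']; exact h3.le
    have herr := hwerr (S ω) ⟨c', hc'⟩
    have htri : ∑ t, w (S ω) t * D.real {x | maj t x ≠ c x} ≤
        ∑ t, w (S ω) t * D.real {x | maj t x ≠ c' x} + γ := by
      have hone : γ = ∑ t, w (S ω) t * γ := by rw [← Finset.sum_mul, (hw (S ω)).2, one_mul]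
      rw [hone, ← Finset.sum_add_distrib]
      refine Finset.sum_le_sum fun t _ => ?_
      rw [← mul_add]
      refine mul_le_mul_of_nonneg_left ?_ ((hw (S ω)).1 t)
      exact (measureReal_ne_triangle D (maj t) c' c).trans (by linarith)
    simp only at herr
    change ∑ t, w (S ω) t * D.real {x | maj t x ≠ c' x} ≤ _ at herr
    linarith
  have hδ₁ : 0 ≤ δ₁ := (Real.exp_pos _).le.trans hdev
  have hB₁ : P (x ⁻¹' B₁) ≤ ENNReal.ofReal δ₁ := by
    -- This inequality holds for arbitrary sets, so the bad events need not be shown measurable.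
    refine (Measure.le_map_apply hS.clean.aemeasurable _).trans ?_
    rw [hS.clean.map_eq]
    exact (measure_pi_exists_ne_le D c c' hcc').trans (ENNReal.ofReal_le_ofReal hγδ)
  have hB₂ : P (x ⁻¹' B₂) ≤ ENNReal.ofReal δ₁ := by
    refine (Measure.le_map_apply hS.clean.aemeasurable _).trans ?_
    rw [hS.clean.map_eq, ← ofReal_measureReal]
    exact ENNReal.ofReal_le_ofReal ((measureReal_voteWeight_deviation_le hn hk D N hNm d hd0
      (fun T hT => hd T (hT.mono hN)) c' (hNm c' hc') hτ).trans hdev)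
  have hB₃ : P ((fun ω => (J ω).card) ⁻¹' B₃) ≤ ENNReal.ofReal δ₁ := by
    refine (Measure.le_map_apply hS.card_corrupted.aemeasurable _).trans ?_
    rw [hS.card_corrupted.map_eq, ← ofReal_measureReal]
    exact ENNReal.ofReal_le_ofReal ((binomial_real_tail_le n η hτ hτ1).trans htail)
  calc P _ ≤ P (x ⁻¹' B₁ ∪ x ⁻¹' B₂ ∪ (fun ω => (J ω).card) ⁻¹' B₃) := measure_mono hsub
    _ ≤ P (x ⁻¹' B₁) + P (x ⁻¹' B₂) + P ((fun ω => (J ω).card) ⁻¹' B₃) :=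
        (measure_union_le _ _).trans (add_le_add_left (measure_union_le _ _) _)
    _ ≤ ENNReal.ofReal δ₁ + ENNReal.ofReal δ₁ + ENNReal.ofReal δ₁ :=
        add_le_add (add_le_add hB₁ hB₂) hB₃
    _ = ENNReal.ofReal (3 * δ₁) := by
        rw [← ENNReal.ofReal_add hδ₁ hδ₁, ← ENNReal.ofReal_add (by linarith) hδ₁]
        ring_nf

end Learner

end NastyLearning

/-! ### Choice of constants. -/

theorem mainTheorem4 :
    ∃ K : ℝ, 0 < K ∧
      ∀ (X : Type u) [MeasurableSpace X] (C : Set (X → Bool)) (D : Measure X)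
        [IsProbabilityMeasure D] (d : ℕ),
        C.Nonempty → (∀ c ∈ C, Measurable c) → NastyLearning.vcDim C = (d : ℕ∞) →
        ∀ ε δ : ℝ, 0 < ε → 0 < δ → δ < 1 →
        ∀ n k : ℕ, K * ((d : ℝ) + Real.log (1 / δ)) / ε ^ 2 ≤ (n : ℝ) → K / ε ^ 2 ≤ (k : ℝ) →
          ∃ A : (Fin n → X × Bool) → PMF (X → Bool),
            (∀ S : Fin n → X × Bool, (A S).support ⊆ NastyLearning.Maj k C) ∧
            ∀ η : unitInterval,
              NastyLearning.LearnsWithNastyNoise.{u, v} C D η ((η : ℝ) + ε) δ A := by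
  refine ⟨200000, by norm_num, ?_⟩
  intro X _ C D _ d hne hC hvc ε δ hε hδ hδ1 n k hn hk
  obtain ⟨c₀, hc₀⟩ := hne
  have hk' : (0 : ℝ) < k := lt_of_lt_of_le (by positivity) hk
  have hk0 : 0 < k := by exact_mod_cast hk'
  -- For `d = 0` the class is a single concept. Otherwise `d ≥ 1` absorbs the additive constants
  -- into the sample bound.
  rcases Nat.eq_zero_or_pos d with rfl | hd0
  · refine NastyLearning.exists_learner_of_error_le D n hk0 δ hc₀ fun c hc => ?_
    rw [NastyLearning.eq_of_vcDim_eq_zero hvc hc₀ hc]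
    simp
  rcases lt_or_ge 1 ε with hε1 | hε1
  · refine NastyLearning.exists_learner_of_error_le D n hk0 δ hc₀ fun c _ => ?_
    exact prob_le_one.trans (by rw [← ENNReal.ofReal_one]; exact ENNReal.ofReal_le_ofReal hε1.le)
  have hL : 0 < Real.log (1 / δ) := Real.log_pos (by rw [lt_div_iff₀ hδ]; linarith)
  have hd1 : (1 : ℝ) ≤ d := by exact_mod_cast hd0
  have hn' : (0 : ℝ) < n := lt_of_lt_of_le (by positivity) hn
  have hn0 : 0 < n := by exact_mod_cast hn'
  rw [div_le_iff₀ (by positivity)] at hn hk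
  have hγ : 0 < min (ε / 4) (δ / (4 * n)) := lt_min (by positivity) (by positivity)
  -- Only finiteness of the net matters, so `γ` may be as small as `δ / (4 n)`; its size enters no
  -- bound.
  obtain ⟨N, hN, -, hnet⟩ := NastyLearning.exists_net D C hC hγ
    ((min_le_left _ _).trans (by linarith)) d hd0 (NastyLearning.card_le_of_vcDim_eq hvc)
  obtain ⟨s, hs, -⟩ := hnet c₀ hc₀
  have : Nonempty N := ⟨⟨s, hs⟩⟩
  have hlog4 : Real.log 4 ≤ 2 := by
    have : Real.log 4 = 2 * Real.log 2 := by
      rw [show (4 : ℝ) = 2 ^ 2 by norm_num, Real.log_pow]; norm_num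
    linarith [Real.log_two_lt_d9]
  have hexp : ∀ z : ℝ, z ≤ -(Real.log (1 / δ) + 2) → Real.exp z ≤ δ / 4 := by
    intro z hz
    have e : Real.log (δ / 4) = -(Real.log (1 / δ) + Real.log 4) := by
      rw [Real.log_div hδ.ne' (by norm_num), one_div, Real.log_inv]; ring
    rw [← Real.le_log_iff_exp_le (by positivity), e]
    linarith
  have hkτ : 1 / √(k : ℝ) ≤ ε / 4 := by
    have h1 : 4 / ε ≤ √(k : ℝ) := by
      refine Real.le_sqrt_of_sq_le ?_
      rw [div_pow, div_le_iff₀ (by positivity)]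
      linarith
    rw [div_le_iff₀ (Real.sqrt_pos.2 hk')]
    rw [div_le_iff₀ hε] at h1
    linarith
  -- With `τ = ε / 4` the deviation exponent is `12 d - n ε ^ 2 / 10496`, and `n ε ^ 2 ≥ 200000 (d +
  -- log (1 / δ))` brings it below `-(log (1 / δ) + 2)`. Three failures of `δ / 4` stay within `δ`.
  obtain ⟨A, hA, hlearn⟩ := NastyLearning.exists_learner_of_net.{u, v} C hC D d hd0
    (NastyLearning.card_le_of_vcDim_eq hvc) hn0 hk0 (τ := ε / 4)
    (γ := min (ε / 4) (δ / (4 * n))) (δ₁ := δ / 4) (by linarith) (by linarith) hkτ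
    (min_le_left _ _)
    (by
      refine (mul_le_mul_of_nonneg_left (min_le_right _ _) hn'.le).trans_eq ?_
      field_simp)
    (hexp _ (by nlinarith)) (hexp _ (by nlinarith)) N hN
    (fun c hc => let ⟨c', hc', h⟩ := hnet c hc; ⟨c', hc', h.le⟩)
  refine ⟨A, hA, fun η c hc Ω _ P _ x J S hS => ?_⟩
  have h := hlearn η c hc Ω P x J S hS
  rw [mul_div_cancel₀ ε (four_ne_zero' ℝ)] at h
  exact h.trans (ENNReal.ofReal_le_ofReal (by linarith))
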